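/- Equip $\mathbb{R}\times\mathbb{Z}\subset\mathbb{R}^2$ with the product of Lebesgue and counting measure, $\int_{\mathbb{R}\times\mathbb{Z}}F(w)\,dw=\sum_{n\in\mathbb{Z}}\int_{\mathbb{R}}F(\xi,n)\,d\xi$, and with the Euclidean dot product and distance. For $\delta\in 2^{\mathbb{N}}$ let $\mathcal{C}_\delta$ be the set of boxes $[m\delta,(m+1)\delta]\times\{n\delta,n\delta+1,\dots,(n+1)\delta\}$, $m,n\in\mathbb{Z}$. For every $\rho>0$ there is a constant $c>0$ such that for all sequences $(A_N)_{N\ge0}$, $(B_N)_{N\ge0}$ of real numbers there is a finite constant $C$, depending only on $\rho$, $(A_N)$ and $(B_N)$, with the following property. Let $\delta\in2^{\mathbb{N}}$ and $T>0$ satisfy $1\le c\,\delta$ and $\delta\le c\,T^{-1}$; let $\theta\in\mathcal{C}_\delta$ satisfy $\delta\le c\,\mathrm{dist}((0,0),\theta)$; let $b\in C^\infty(\mathbb{R};\mathbb{C})$ be a symbol of order $\frac12$, i.e. $|b^{(N)}(s)|\le A_N(1+|s|)^{\frac12-N}$ for all $N\ge0$ and $s\in\mathbb{R}$, with $\operatorname{supp}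 b\subset[-\frac{T\delta^2}{4},\frac{T\delta^2}{4}]$; and let $\chi_\theta\in C^\infty(\mathbb{R}^2;\mathbb{R})$ be a smooth cut-off function adapted to $\theta$, i.e. $\chi_\theta(x)=0$ unless there is $y\in\theta$ with $|x_1-y_1|\le\rho\delta$ and $|x_2-y_2|\le\rho\delta$, and $\|D^N\chi_\theta(x)\|\le B_N\delta^{-N}$ for all $N\ge0$ and $x\in\mathbb{R}^2$, where $\|\cdot\|$ is the operator norm of the $N$-linear form $D^N\chi_\theta(x)$ with respect to the maximum norm on $\mathbb{R}^2$. Then for every $G\in L^2(\mathbb{R}\times\mathbb{Z})$ the integral $$V(G)(y)=\delta^{-2}\int_{\mathbb{R}\times\mathbb{Z}}\int_{\mathbb{R}}e^{2\pi i\delta^{-2}s(y-w)\cdot y}\,b(s)\,G(w)\,\chi_\theta(y)\chi_\theta(w)\,ds\,dw$$ converges absolutely for every $y\in\mathbb{R}\times\mathbb{Z}$, $V(G)\in L^2(\mathbb{R}\times\mathbb{Z})$, and $$\|V(G)\|_{L^2(\mathbb{R}\times\mathbb{Z})}\le C\,\|G\|_{L^2(\mathbb{R}\times\mathbb{Z})}.$$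 -/

import Mathlib

open MeasureTheory
open scoped ContDiff NNReal

noncomputable section

namespace Waveguide

/-- Lebesgue measure times counting measure on `ℝ × ℤ`, so that
`∫ F = ∑ n, ∫ F (ξ, n) dξ`. -/
def μ : Measure (ℝ × ℤ) := (volume : Measure ℝ).prod Measure.count

/-- The Euclidean dot product of two points of `ℝ × ℤ ⊆ ℝ²`. -/
def dot (y w : ℝ × ℤ) : ℝ := y.1 * w.1 + (y.2 : ℝ) * (w.2 : ℝ)

/-- The `δ`-boxes `[mδ, (m+1)δ] × {nδ, nδ + 1, …, (n+1)δ}`, `m, n ∈ ℤ`. -/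
def boxes (δ : ℝ) : Set (Set (ℝ × ℤ)) :=
  {θ | ∃ m n : ℤ, θ = {y : ℝ × ℤ | (m * δ ≤ y.1 ∧ y.1 ≤ (m + 1) * δ) ∧
    (n * δ ≤ (y.2 : ℝ) ∧ (y.2 : ℝ) ≤ (n + 1) * δ)}}

/-- The Euclidean distance from the origin to a (nonempty) set `θ ⊆ ℝ × ℤ`. -/
def distOrigin (θ : Set (ℝ × ℤ)) : ℝ := sInf ((fun y => √(dot y y)) '' θ)

/-- `b` is smooth of order `m`, with constants `A`:
`|b^{(N)}(s)| ≤ A_N (1 + |s|)^{m - N}` for all `N` and `s`. -/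
structure IsSymbol (m : ℝ) (A : ℕ → ℝ) (b : ℝ → ℂ) : Prop where
  smooth : ContDiff ℝ ∞ b
  bound : ∀ (N : ℕ) (s : ℝ), ‖iteratedDeriv N b s‖ ≤ A N * (1 + |s|) ^ (m - (N : ℝ))

/-- `χ` is a smooth cut-off function adapted to the `δ`-box `θ`: it lives on `ℝ²` (and is used
on `ℝ × ℤ` by restriction), it vanishes outside the `ρδ`-neighbourhood of `θ`, and its derivatives
of order `N` are at most `B_N δ^{-N}`. It is not required to be equal to `1` on `θ`, so that
those cut-off functions that are, and those that are supported inside the box, are all covered. -/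
structure IsCutoff (ρ : ℝ) (B : ℕ → ℝ) (δ : ℝ) (θ : Set (ℝ × ℤ)) (χ : ℝ × ℝ → ℝ) : Prop where
  smooth : ContDiff ℝ ∞ χ
  support : ∀ x, χ x ≠ 0 → ∃ y ∈ θ, |x.1 - y.1| ≤ ρ * δ ∧ |x.2 - (y.2 : ℝ)| ≤ ρ * δ
  bound : ∀ (N : ℕ) (x : ℝ × ℝ), ‖iteratedFDeriv ℝ N χ x‖ ≤ B N * δ ^ (-(N : ℝ))

/-- The integrand `e^{2πi δ⁻² s (y-w)·y} b(s) G(w) χ(y) χ(w)`. -/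
def integrand (δ : ℝ) (b : ℝ → ℂ) (χ : ℝ × ℝ → ℝ) (G : ℝ × ℤ → ℂ) (y w : ℝ × ℤ) (s : ℝ) : ℂ :=
  Complex.exp (2 * Real.pi * Complex.I * ((δ ^ 2)⁻¹ * s * dot (y - w) y : ℝ)) *
    b s * G w * (χ (y.1, (y.2 : ℝ)) * χ (w.1, (w.2 : ℝ)) : ℝ)

/-- `V(G)(y) = δ⁻² ∫_{ℝ×ℤ} ∫_ℝ e^{2πi δ⁻² s (y-w)·y} b(s) G(w) χ(y) χ(w) ds dw`. -/
def V (δ : ℝ) (b : ℝ → ℂ) (χ : ℝ × ℝ → ℝ) (G : ℝ × ℤ → ℂ) (y : ℝ × ℤ) : ℂ :=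
  ((δ ^ 2)⁻¹ : ℝ) * ∫ w, (∫ s : ℝ, integrand δ b χ G y w s) ∂μ

end Waveguide

end

/-!
The kernel of `V` depends on `y` and `w` through `e(s (y - w) · y) = e(s |y|²) e(-s y · w)` only,
where `e(x) = e^{2πix}` and `s` has been rescaled by `δ²`. Integrating over `w` first gives
`V(G)(y) = χ(y) ∫ β(s) e(s |y|²) F(s y) ds`, with `β(s) = b(δ² s)` and `F` the Fourier transform on
`ℝ × ℤ` of `χ G` (`V_eq_oscInt`). The right-hand side makes sense for all `y ∈ ℝ²`.

*Along a ray.* For `y = r ω` with `|ω| = 1` the integral is, after `s = σ / r`, the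
one-dimensional operator `∫ r⁻¹ β(σ / r) e(σ r) F(σ ω) dσ`. If its symbol did not depend on `r`,
Plancherel's theorem would bound it. The dependence is removed by a Sobolev inequality in an
auxiliary variable (`lintegral_ray_sq_le`), which costs one derivative of `β`. An amplitude of order
`1/2` produces the weight `|σ|`, exactly the Jacobian of polar coordinates in the variable `σ ω`, so
that there is no loss: on the annulus `r₀ ≤ |y| ≤ 2 r₀` the squared `L²` norm of the integral is
`≲ (δ / r₀)² ∫ |F|²`, over the disc of radius `2 S r₀` if `β` lives on `[-S, S]`
(`lintegral_oscInt_sq_le`).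

*The lattice.* Let `R = r₀ / δ` be the distance from the box to the origin in units of `δ`. The
disc above has radius `O(R)`, because `S = T / 4` and `T δ ≲ 1`; as `F` has period `1` in its second
variable, `∫ |F|²` over the disc is `≲ R ‖χ G‖²` (`lintegral_disc_fourier_sq_le`). For the same
reason the derivative in `y₂` costs a factor `O(R)`, so that passing from `ℝ²` to `ℝ × ℤ` by a
Sobolev inequality on intervals of length one costs another factor `R` in the squared norm
(`lintegral_sample_le`). The total is `R⁻² · R · R = 1` (`lintegral_sample_oscInt_le`).

*Low frequencies.* The above needs `|β(s)| ≲ δ |s|^{1/2}` down to `s = 0`, while a symbol is only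
bounded there. The part of `b` that lives on `|s| ≲ 1` is split off with the weight `(1 + s²)⁻²`.
Its contribution has a kernel of size `δ⁻²` on a box of measure `O(δ²)`, and is bounded by the
Cauchy-Schwarz inequality (`lintegral_oscInt_low_le`).
-/

namespace Waveguide

open Set FourierTransform
open scoped ENNReal

/-! ### Fourier analysis on the line, and a Sobolev inequality -/

/-- The character `e(x) = e^{2πix}` of `ℝ`, with values in `ℂ`. -/
noncomputable def e (x : ℝ) : ℂ := Complex.exp (2 * Real.pi * Complex.I * (x : ℝ))

lemma norm_e (x : ℝ) : ‖e x‖ = 1 := by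
  have : (2 * Real.pi * Complex.I * (x : ℝ) : ℂ) = ((2 * Real.pi * x : ℝ) : ℂ) * Complex.I := by
    push_cast; ring
  rw [e, this, Complex.norm_exp_ofReal_mul_I]

lemma e_add (x y : ℝ) : e (x + y) = e x * e y := by
  rw [e, e, e, ← Complex.exp_add]; push_cast; ring_nf

lemma e_zero : e 0 = 1 := by simp [e]

@[fun_prop]
lemma continuous_e : Continuous e := by unfold e; fun_prop

lemma hasDerivAt_e (x : ℝ) : HasDerivAt e (2 * Real.pi * Complex.I * e x) x := by
  have h : HasDerivAt (fun x : ℝ => (2 * Real.pi * Complex.I * (x : ℝ) : ℂ))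
      (2 * Real.pi * Complex.I * 1) x := (Complex.ofRealCLM.hasDerivAt (x := x)).const_mul _
  unfold e
  convert! h.cexp using 1; ring

lemma fourier_eq_integral_e (f : ℝ → ℂ) (x : ℝ) : 𝓕 f x = ∫ v, e (-(v * x)) * f v := by
  rw [Real.fourier_real_eq_integral_exp_smul]
  congr with v
  rw [smul_eq_mul, e]
  push_cast; ring_nf

/-- Plancherel's theorem for the Fourier integral of a function in `L¹ ∩ L²`. -/
theorem lintegral_fourier_sq {f : ℝ → ℂ} (h1 : Integrable f) (h2 : MemLp f 2) :
    ∫⁻ x, ‖𝓕 f x‖ₑ ^ 2 = ∫⁻ x, ‖f x‖ₑ ^ 2 := by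
  set g : Lp ℂ 2 (volume : Measure ℝ) := h2.toLp f with hg
  have hgf : g =ᵐ[volume] f := h2.coeFn_toLp
  have hcont : Continuous (𝓕 f) :=
    VectorFourier.fourierIntegral_continuous Real.continuous_fourierChar (by fun_prop) h1
  -- the `L²` transform of `g` and the integral `𝓕 f` agree as tempered distributions
  have key : ∀ᵐ x, (𝓕 g : Lp ℂ 2 (volume : Measure ℝ)) x = 𝓕 f x := by
    apply ae_eq_of_integral_contDiff_smul_eq
    · exact (Lp.memLp (𝓕 g)).locallyIntegrable (by norm_num)
    · exact hcont.locallyIntegrable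
    intro φ hφ hφ'
    have hψ1 : HasCompactSupport (fun x => (φ x : ℂ)) := hφ'.comp_left (g := ((↑) : ℝ → ℂ)) rfl
    have hψ2 : ContDiff ℝ ∞ (fun x => (φ x : ℂ)) := Complex.ofRealCLM.contDiff.comp hφ
    set ψ := hψ1.toSchwartzMap hψ2 with hψ
    have e1 := Lp.toTemperedDistribution_apply (𝓕 g : Lp ℂ 2 (volume : Measure ℝ)) ψ
    rw [← Lp.fourier_toTemperedDistribution_eq, TemperedDistribution.fourier_apply,
      Lp.toTemperedDistribution_apply] at e1
    have e2 : ∫ x, φ x • (𝓕 g : Lp ℂ 2 (volume : Measure ℝ)) x =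
        ∫ x, ψ x • (𝓕 g : Lp ℂ 2 (volume : Measure ℝ)) x := by
      congr with x
    rw [e2, ← e1]
    have e3 : ∫ x, 𝓕 f x • ψ x = ∫ x, f x • 𝓕 (ψ : ℝ → ℂ) x := by
      simpa using! VectorFourier.integral_fourierIntegral_smul_eq_flip (L := innerₗ ℝ)
        Real.continuous_fourierChar continuous_inner h1 ψ.integrable
    have e4 : ∫ x, φ x • 𝓕 f x = ∫ x, 𝓕 f x • ψ x := by
      congr with x
      rw [smul_eq_mul, mul_comm]; rfl
    rw [e4, e3]
    apply integral_congr_ae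
    filter_upwards [hgf] with x hx
    rw [hx, smul_eq_mul, smul_eq_mul, mul_comm]; rfl
  have hn := Lp.norm_fourier_eq g
  have hn' : eLpNorm (𝓕 g : Lp ℂ 2 (volume : Measure ℝ)) 2 volume = eLpNorm g 2 volume := by
    rw [← Lp.enorm_def, ← Lp.enorm_def, ← ofReal_norm, ← ofReal_norm, hn]
  rw [eLpNorm_congr_ae key, eLpNorm_congr_ae hgf] at hn'
  have p1 := eLpNorm_nnreal_pow_eq_lintegral (f := 𝓕 f) (μ := volume) (p := 2) (by norm_num)
  have p2 := eLpNorm_nnreal_pow_eq_lintegral (f := f) (μ := volume) (p := 2) (by norm_num)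
  simp only [ENNReal.coe_ofNat, NNReal.coe_ofNat, ENNReal.rpow_ofNat] at p1 p2
  rw [← p1, ← p2, hn']

/-- Differentiation under the integral sign, for a jointly continuous function integrated against
an integrable weight that vanishes outside a bounded interval. -/
theorem hasDerivAt_integral_mul {φ φ' : ℝ → ℝ → ℂ} {k : ℝ → ℂ} {E : ℝ} (hk : Integrable k)
    (hkE : ∀ s, k s ≠ 0 → |s| ≤ E) (hφ : Continuous fun p : ℝ × ℝ => φ p.1 p.2)
    (hφ' : Continuous fun p : ℝ × ℝ => φ' p.1 p.2)
    (hd : ∀ t s, HasDerivAt (fun t => φ t s) (φ' t s) t) :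
    (∀ t, HasDerivAt (fun t => ∫ s, φ t s * k s) (∫ s, φ' t s * k s) t) ∧
      Continuous fun t => ∫ s, φ' t s * k s := by
  have bd : ∀ {f : ℝ → ℝ → ℂ}, Continuous (fun p : ℝ × ℝ => f p.1 p.2) → ∀ t₀ : ℝ, ∃ C,
      ∀ t ∈ Metric.ball t₀ 1, ∀ s, ‖f t s * k s‖ ≤ C * ‖k s‖ := by
    intro f hf t₀
    obtain ⟨C, hC⟩ := ((isCompact_closedBall t₀ 1).prod (isCompact_Icc (a := -E) (b := E))
      ).exists_bound_of_continuousOn hf.continuousOn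
    refine ⟨C, fun t ht s => ?_⟩
    by_cases h : k s = 0
    · simp [h]
    · rw [norm_mul]
      gcongr
      exact hC (t, s) ⟨Metric.ball_subset_closedBall ht, abs_le.1 (hkE s h)⟩
  have ms : ∀ {f : ℝ → ℝ → ℂ}, Continuous (fun p : ℝ × ℝ => f p.1 p.2) → ∀ t,
      AEStronglyMeasurable (fun s => f t s * k s) volume := fun {f} hf t =>
    (Continuous.aestronglyMeasurable (f := fun s => f t s)
      (hf.comp (Continuous.prodMk_right t))).mul hk.1
  constructor
  · intro t₀
    obtain ⟨C, hC⟩ := bd hφ' t₀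
    obtain ⟨C', hC'⟩ := bd hφ t₀
    refine (hasDerivAt_integral_of_dominated_loc_of_deriv_le (Metric.ball_mem_nhds t₀ one_pos)
      (.of_forall fun t => ms hφ t) ?_ (ms hφ' t₀) (.of_forall fun s t ht => hC t ht s)
      (hk.norm.const_mul C) (.of_forall fun s t _ => (hd t s).mul_const _)).2
    exact (hk.norm.const_mul C').mono' (ms hφ t₀)
      (.of_forall fun s => hC' t₀ (Metric.mem_ball_self one_pos) s)
  · rw [continuous_iff_continuousAt]
    intro t₀
    obtain ⟨C, hC⟩ := bd hφ' t₀
    refine continuousAt_of_dominated (.of_forall fun t => ms hφ' t)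
      (bound := fun s => C * ‖k s‖) ?_ (hk.norm.const_mul C) ?_
    · filter_upwards [Metric.ball_mem_nhds t₀ one_pos] with t ht
      exact .of_forall fun s => hC t ht s
    · refine .of_forall fun s => ?_
      have : Continuous fun t => φ' t s := hφ'.comp (Continuous.prodMk_left s)
      fun_prop

/-- A one-dimensional Sobolev inequality: a value of a `C¹` function on an interval is controlled
by the `L²` norms of the function and of its derivative, with a free parameter `q` to balance the
two. -/
theorem enorm_sq_le_lintegral {u u' : ℝ → ℂ} (hu : ∀ t, HasDerivAt u (u' t) t)
    (hu' : Continuous u') {a b q : ℝ} (hab : a < b) (hq : 0 < q) {x : ℝ} (hx : x ∈ Icc a b) :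
    ‖u x‖ₑ ^ 2 ≤ ∫⁻ t in Ioc a b, (ENNReal.ofReal ((b - a)⁻¹ + q) * ‖u t‖ₑ ^ 2 +
      ENNReal.ofReal q⁻¹ * ‖u' t‖ₑ ^ 2) := by
  have hc : Continuous u := continuous_iff_continuousAt.2 fun t => (hu t).continuousAt
  -- the derivative of `‖u‖²` is at most `q ‖u‖² + q⁻¹ ‖u'‖²` in absolute value
  set v' : ℝ → ℝ := fun t => 2 * inner ℝ (u t) (u' t) with hv'
  have hv : ∀ t, HasDerivAt (fun t => ‖u t‖ ^ 2) (v' t) t := fun t => (hu t).norm_sq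
  have hv'c : Continuous v' := by rw [hv']; fun_prop
  set w : ℝ → ℝ := fun t => q * ‖u t‖ ^ 2 + q⁻¹ * ‖u' t‖ ^ 2 with hw
  have hwc : Continuous w := by rw [hw]; fun_prop
  have hvw : ∀ t, |v' t| ≤ w t := by
    intro t
    have h1 : |v' t| ≤ 2 * (‖u t‖ * ‖u' t‖) := by
      rw [hv', abs_mul, abs_two]
      gcongr
      exact abs_real_inner_le_norm _ _
    have h2 : w t - 2 * (‖u t‖ * ‖u' t‖) = q⁻¹ * (q * ‖u t‖ - ‖u' t‖) ^ 2 := by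
      rw [hw]; field_simp; ring
    have h3 : 0 ≤ q⁻¹ * (q * ‖u t‖ - ‖u' t‖) ^ 2 := by positivity
    linarith
  have hw0 : ∀ t, 0 ≤ w t := fun t => (abs_nonneg _).trans (hvw t)
  have hdiff : ∀ t ∈ Icc a b, ‖u x‖ ^ 2 ≤ ‖u t‖ ^ 2 + ∫ s in a..b, w s := by
    intro t ht
    have h1 : ∫ s in t..x, v' s = ‖u x‖ ^ 2 - ‖u t‖ ^ 2 :=
      intervalIntegral.integral_eq_sub_of_hasDerivAt (fun s _ => hv s)
        (hv'c.intervalIntegrable _ _)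
    have h2 : ‖∫ s in t..x, v' s‖ ≤ ∫ s in uIoc t x, ‖v' s‖ :=
      intervalIntegral.norm_integral_le_integral_norm_uIoc
    have h3 : ∫ s in uIoc t x, ‖v' s‖ ≤ ∫ s in Ioc a b, w s := by
      have hsub : uIoc t x ⊆ Ioc a b := by
        intro s hs
        rw [mem_uIoc] at hs
        rcases hs with h | h
        · exact ⟨ht.1.trans_lt h.1, h.2.trans hx.2⟩
        · exact ⟨hx.1.trans_lt h.1, h.2.trans ht.2⟩
      have hi : IntegrableOn w (Ioc a b) :=
        (hwc.integrableOn_Icc (a := a) (b := b)).mono_set Ioc_subset_Icc_self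
      calc ∫ s in uIoc t x, ‖v' s‖ ≤ ∫ s in uIoc t x, w s :=
            integral_mono (hv'c.norm.integrableOn_uIcc.mono_set uIoc_subset_uIcc)
              (hi.mono_set hsub) fun s => hvw s
        _ ≤ _ := setIntegral_mono_set hi (.of_forall hw0) hsub.eventuallyLE
    rw [intervalIntegral.integral_of_le hab.le]
    have := le_abs_self (∫ s in t..x, v' s)
    rw [Real.norm_eq_abs] at h2
    linarith
  have hmean : ‖u x‖ ^ 2 ≤ ∫ t in a..b, (((b - a)⁻¹ + q) * ‖u t‖ ^ 2 + q⁻¹ * ‖u' t‖ ^ 2) := by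
    have h1 : ∫ t in a..b, ‖u x‖ ^ 2 ≤ ∫ t in a..b, (‖u t‖ ^ 2 + ∫ s in a..b, w s) :=
      intervalIntegral.integral_mono_on hab.le (by simp)
        (Continuous.intervalIntegrable (by fun_prop) _ _) hdiff
    have hs : 0 < b - a := sub_pos.2 hab
    rw [intervalIntegral.integral_add (Continuous.intervalIntegrable (by fun_prop) _ _) (by simp),
      intervalIntegral.integral_const, intervalIntegral.integral_const, smul_eq_mul,
      smul_eq_mul] at h1
    have h2 : ∫ t in a..b, (((b - a)⁻¹ + q) * ‖u t‖ ^ 2 + q⁻¹ * ‖u' t‖ ^ 2) =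
        (b - a)⁻¹ * (∫ t in a..b, ‖u t‖ ^ 2) + ∫ t in a..b, w t := by
      rw [← intervalIntegral.integral_const_mul, ← intervalIntegral.integral_add
        (Continuous.intervalIntegrable (by fun_prop) _ _) (hwc.intervalIntegrable _ _)]
      congr with t
      rw [hw]; ring
    rw [h2, ← mul_le_mul_iff_right₀ hs]
    refine h1.trans_eq ?_
    field_simp
  have hpos : ∀ t, 0 ≤ ((b - a)⁻¹ + q) * ‖u t‖ ^ 2 + q⁻¹ * ‖u' t‖ ^ 2 := fun t => by
    have : 0 < b - a := sub_pos.2 hab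
    positivity
  calc ‖u x‖ₑ ^ 2 = ENNReal.ofReal (‖u x‖ ^ 2) := by
        rw [ENNReal.ofReal_pow (norm_nonneg _), ofReal_norm]
    _ ≤ ENNReal.ofReal (∫ t in Ioc a b,
          (((b - a)⁻¹ + q) * ‖u t‖ ^ 2 + q⁻¹ * ‖u' t‖ ^ 2)) := by
        rw [← intervalIntegral.integral_of_le hab.le]
        exact ENNReal.ofReal_le_ofReal hmean
    _ = _ := by
        rw [ofReal_integral_eq_lintegral_ofReal _ (.of_forall hpos)]
        · refine lintegral_congr fun t => ?_
          have : 0 < b - a := sub_pos.2 hab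
          rw [ENNReal.ofReal_add (by positivity) (by positivity),
            ENNReal.ofReal_mul (by positivity), ENNReal.ofReal_mul (by positivity),
            ENNReal.ofReal_pow (norm_nonneg _), ENNReal.ofReal_pow (norm_nonneg _),
            ofReal_norm, ofReal_norm]
        · exact (Continuous.integrableOn_Icc (by fun_prop)).mono_set Ioc_subset_Icc_self

/-! ### The estimate along a ray -/

/-- Plancherel's theorem for a continuous function cut off to a bounded interval. -/
lemma lintegral_integral_e_mul_indicator_sq {f : ℝ → ℂ} (hf : Continuous f) (E : ℝ) :
    ∫⁻ x, ‖∫ σ, e (σ * x) * (Icc (-E) E).indicator f σ‖ₑ ^ 2 =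
      ∫⁻ σ in Icc (-E) E, ‖f σ‖ₑ ^ 2 := by
  have hm : ∀ p : ℝ≥0∞, MemLp ((Icc (-E) E).indicator f) p volume := by
    intro p
    rw [memLp_indicator_iff_restrict measurableSet_Icc]
    obtain ⟨C, hC⟩ := (isCompact_Icc (a := -E) (b := E)).exists_bound_of_continuousOn
      hf.continuousOn
    exact MemLp.of_bound hf.aestronglyMeasurable C
      ((ae_restrict_iff' measurableSet_Icc).2 (.of_forall hC))
  have h1 := lintegral_fourier_sq (memLp_one_iff_integrable.1 (hm 1)) (hm 2)
  have h2 : ∀ x, ∫ σ, e (σ * x) * (Icc (-E) E).indicator f σ =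
      𝓕 ((Icc (-E) E).indicator f) (-x) := by
    intro x
    rw [fourier_eq_integral_e]
    congr with v
    rw [mul_neg, neg_neg]
  have hc : Continuous (𝓕 ((Icc (-E) E).indicator f)) :=
    VectorFourier.fourierIntegral_continuous Real.continuous_fourierChar (by fun_prop)
      (memLp_one_iff_integrable.1 (hm 1))
  simp_rw [h2]
  rw [(Measure.measurePreserving_neg (volume : Measure ℝ)).lintegral_comp
    (f := fun x => ‖𝓕 ((Icc (-E) E).indicator f) x‖ₑ ^ 2) (by fun_prop), h1,
    ← lintegral_indicator measurableSet_Icc]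
  congr with σ
  by_cases h : σ ∈ Icc (-E) E <;> simp [h]

/-- `β`, with derivative `β'`, is a `C¹` amplitude supported in `[-S, S]` which is of order `1/2`
in the homogeneous sense: both `|β(s)|` and `|s β'(s)|` are at most `M |s|^{1/2}`. -/
structure IsAmplitude (S M : ℝ) (β β' : ℝ → ℂ) : Prop where
  hasDerivAt : ∀ s, HasDerivAt β (β' s) s
  continuous_deriv : Continuous β'
  support : ∀ s, β s ≠ 0 → |s| ≤ S
  bound : ∀ s, ‖β s‖ ^ 2 ≤ M ^ 2 * |s|
  bound_deriv : ∀ s, ‖s * β' s‖ ^ 2 ≤ M ^ 2 * |s|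

namespace IsAmplitude

variable {S M : ℝ} {β β' : ℝ → ℂ}

lemma continuous (h : IsAmplitude S M β β') : Continuous β :=
  continuous_iff_continuousAt.2 fun s => (h.hasDerivAt s).continuousAt

lemma integrable (h : IsAmplitude S M β β') : Integrable β := by
  apply h.continuous.integrable_of_hasCompactSupport
  exact HasCompactSupport.intro (isCompact_Icc (a := -S) (b := S))
    fun s hs => by_contra fun h' => hs (abs_le.1 (h.support s h'))

end IsAmplitude

lemma enorm_sq_le_ofReal {z : ℂ} {x : ℝ} (h : ‖z‖ ^ 2 ≤ x) : ‖z‖ₑ ^ 2 ≤ ENNReal.ofReal x := by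
  rw [← ofReal_norm, ← ENNReal.ofReal_pow (norm_nonneg _)]
  exact ENNReal.ofReal_le_ofReal h

lemma measurable_integral_mul_indicator {a : ℝ → ℝ → ℂ} {g : ℝ → ℂ}
    (ha : Continuous fun p : ℝ × ℝ => a p.1 p.2) (hg : Continuous g) (E : ℝ) :
    Measurable fun p : ℝ × ℝ =>
      ∫ σ, a p.2 σ * e (σ * p.1) * (Icc (-E) E).indicator g σ := by
  refine (StronglyMeasurable.integral_prod_right (ν := volume)
    (f := fun (p : ℝ × ℝ) σ => a p.2 σ * e (σ * p.1) * (Icc (-E) E).indicator g σ) ?_).measurable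
  refine Measurable.stronglyMeasurable (Measurable.mul ?_ ?_)
  · have : Continuous fun q : (ℝ × ℝ) × ℝ => a q.1.2 q.2 :=
      ha.comp (by fun_prop : Continuous fun q : (ℝ × ℝ) × ℝ => (q.1.2, q.2))
    exact Continuous.measurable
      (f := fun q : (ℝ × ℝ) × ℝ => a q.1.2 q.2 * e (q.2 * q.1.1)) (by fun_prop)
  · exact (hg.measurable.indicator measurableSet_Icc).comp measurable_snd

/-- A multiplier bound: Plancherel's theorem for a Fourier integral with amplitude `a`. -/
lemma lintegral_multiplier_sq_le {a g : ℝ → ℂ} {E C : ℝ} (ha : Continuous a) (hg : Continuous g)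
    (hC : 0 ≤ C) (hb : ∀ σ, ‖a σ‖ ^ 2 ≤ C * |σ|) :
    ∫⁻ x, ‖∫ σ, a σ * e (σ * x) * (Icc (-E) E).indicator g σ‖ₑ ^ 2 ≤
      ENNReal.ofReal C * ∫⁻ σ in Icc (-E) E, ENNReal.ofReal |σ| * ‖g σ‖ₑ ^ 2 := by
  have h1 : ∫⁻ x, ‖∫ σ, a σ * e (σ * x) * (Icc (-E) E).indicator g σ‖ₑ ^ 2 =
      ∫⁻ σ in Icc (-E) E, ‖a σ * g σ‖ₑ ^ 2 := by
    rw [← lintegral_integral_e_mul_indicator_sq (f := fun σ => a σ * g σ) (by fun_prop)]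
    refine lintegral_congr fun x => ?_
    congr 2
    refine integral_congr_ae (.of_forall fun σ => ?_)
    by_cases hσ : σ ∈ Icc (-E) E
    · simp only [indicator_of_mem hσ]; ring
    · simp only [indicator_of_notMem hσ, mul_zero]
  rw [h1, ← lintegral_const_mul' _ _ ENNReal.ofReal_ne_top]
  refine lintegral_mono fun σ => ?_
  rw [enorm_mul, mul_pow, ← mul_assoc, ← ENNReal.ofReal_mul hC]
  gcongr
  exact enorm_sq_le_ofReal (hb σ)

/-- The substitution `s = σ / r`. -/
lemma integral_ray_eq {S r₀ r : ℝ} {β g : ℝ → ℂ} (hβ : ∀ s, β s ≠ 0 → |s| ≤ S) (hr0 : 0 < r)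
    (hr : r ≤ 2 * r₀) :
    ∫ s, β s * e (s * r ^ 2) * g (s * r) =
      ∫ σ, ((r⁻¹ : ℝ) : ℂ) * β (r⁻¹ * σ) * e (σ * r) *
        (Icc (-(2 * S * r₀)) (2 * S * r₀)).indicator g σ := by
  have h1 := Measure.integral_comp_mul_left
    (fun s => β s * e (s * r ^ 2) * g (s * r)) r⁻¹
  rw [inv_inv, abs_of_pos hr0] at h1
  have h2 : ∫ s, β s * e (s * r ^ 2) * g (s * r) = (r⁻¹ : ℝ) •
      ∫ x, β (r⁻¹ * x) * e (r⁻¹ * x * r ^ 2) * g (r⁻¹ * x * r) := by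
    rw [h1, smul_smul, inv_mul_cancel₀ hr0.ne', one_smul]
  rw [h2, ← integral_smul]
  refine integral_congr_ae (.of_forall fun σ => ?_)
  have e1 : r⁻¹ * σ * r ^ 2 = σ * r := by field_simp
  have e2 : r⁻¹ * σ * r = σ := by field_simp
  simp only [e1, e2, Complex.real_smul]
  by_cases hσ : σ ∈ Icc (-(2 * S * r₀)) (2 * S * r₀)
  · rw [indicator_of_mem hσ]; ring
  · have : β (r⁻¹ * σ) = 0 := by
      by_contra hne
      apply hσ
      have h3 := hβ _ hne
      rw [abs_mul, abs_of_pos (inv_pos.2 hr0), inv_mul_le_iff₀ hr0] at h3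
      have h4 : 0 ≤ S := (abs_nonneg _).trans (hβ _ hne)
      apply abs_le.1
      nlinarith
    simp [this]

/-- The one-dimensional estimate behind the theorem. With `s = σ / r` the integral is a
pseudodifferential operator whose symbol `r⁻¹ β(σ / r)` depends on `r`. Freezing that dependence
(as the parameter `l = r⁻¹`, removed again by the Sobolev inequality) leaves a Fourier multiplier
for each `l`, so that no regularity of the symbol in `σ` and no orthogonality between dyadic pieces
is needed. -/
theorem lintegral_ray_sq_le {S M r₀ : ℝ} {β β' g : ℝ → ℂ} (h : IsAmplitude S M β β')
    (hr : 0 < r₀) (hg : Continuous g) :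
    ∫⁻ r in Icc r₀ (2 * r₀), ‖∫ s, β s * e (s * r ^ 2) * g (s * r)‖ₑ ^ 2 ≤
      ENNReal.ofReal (3 * M ^ 2 / r₀ ^ 3) *
        ∫⁻ σ in Icc (-(2 * S * r₀)) (2 * S * r₀), ENNReal.ofReal |σ| * ‖g σ‖ₑ ^ 2 := by
  obtain ⟨E, hE⟩ : ∃ E, E = 2 * S * r₀ := ⟨_, rfl⟩
  have hβ := h.continuous
  have hβ' := h.continuous_deriv
  obtain ⟨a, ha⟩ : ∃ a : ℝ → ℝ → ℂ, a = fun l σ => l * β (l * σ) := ⟨_, rfl⟩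
  obtain ⟨a', ha'⟩ : ∃ a' : ℝ → ℝ → ℂ,
    a' = fun l σ => β (l * σ) + (l * σ : ℝ) * β' (l * σ) := ⟨_, rfl⟩
  have hac : Continuous fun p : ℝ × ℝ => a p.1 p.2 := by rw [ha]; fun_prop
  have hac' : Continuous fun p : ℝ × ℝ => a' p.1 p.2 := by rw [ha']; fun_prop
  have had : ∀ l σ, HasDerivAt (fun l => a l σ) (a' l σ) l := by
    intro l σ
    have h1 : HasDerivAt (fun l : ℝ => (l : ℂ)) 1 l := Complex.ofRealCLM.hasDerivAt
    have h2 : HasDerivAt (fun l : ℝ => β (l * σ)) (σ • β' (l * σ)) l :=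
      (h.hasDerivAt (l * σ)).scomp l (hasDerivAt_mul_const σ)
    rw [ha, ha']
    convert! h1.mul h2 using 1
    simp only [Complex.real_smul]
    push_cast; ring
  obtain ⟨F, hF⟩ : ∃ F : ℝ → ℝ → ℂ,
    F = fun l x => ∫ σ, a l σ * e (σ * x) * (Icc (-E) E).indicator g σ := ⟨_, rfl⟩
  obtain ⟨F', hF'⟩ : ∃ F' : ℝ → ℝ → ℂ,
    F' = fun l x => ∫ σ, a' l σ * e (σ * x) * (Icc (-E) E).indicator g σ := ⟨_, rfl⟩
  have hgi : Integrable ((Icc (-E) E).indicator g) := by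
    rw [integrable_indicator_iff measurableSet_Icc]
    exact hg.continuousOn.integrableOn_Icc
  have hgJ : ∀ σ, (Icc (-E) E).indicator g σ ≠ 0 → |σ| ≤ E := fun σ hσ =>
    abs_le.2 (mem_Icc.1 (mem_of_indicator_ne_zero hσ))
  have hFd : ∀ x, (∀ l, HasDerivAt (fun l => F l x) (F' l x) l) ∧ Continuous fun l => F' l x := by
    intro x
    rw [hF, hF']
    exact hasDerivAt_integral_mul (φ := fun l σ => a l σ * e (σ * x))
      (φ' := fun l σ => a' l σ * e (σ * x)) hgi hgJ (by fun_prop) (by fun_prop)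
      fun l σ => (had l σ).mul_const _
  have hFm : Measurable fun p : ℝ × ℝ => F p.2 p.1 := by
    rw [hF]; exact measurable_integral_mul_indicator hac hg E
  have hFm' : Measurable fun p : ℝ × ℝ => F' p.2 p.1 := by
    rw [hF']; exact measurable_integral_mul_indicator hac' hg E
  -- on a ray, the integral is the value of `F` at `l = r⁻¹`, `x = r`
  have hdiag : ∀ r ∈ Icc r₀ (2 * r₀),
      ∫ s, β s * e (s * r ^ 2) * g (s * r) = F r⁻¹ r := by
    intro r hr'
    rw [hF, ha, hE]
    exact integral_ray_eq h.support (hr.trans_le hr'.1) hr'.2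
  rw [← hE]
  obtain ⟨I, hI⟩ : ∃ I, I = ∫⁻ σ in Icc (-E) E, ENNReal.ofReal |σ| * ‖g σ‖ₑ ^ 2 := ⟨_, rfl⟩
  have hb1 : ∀ l ∈ Ioc (2 * r₀)⁻¹ r₀⁻¹,
      ∫⁻ x, ‖F l x‖ₑ ^ 2 ≤ ENNReal.ofReal (M ^ 2 / r₀ ^ 3) * I := by
    intro l hl
    have hl0 : 0 < l := lt_trans (by positivity) hl.1
    rw [hF, hI]
    refine lintegral_multiplier_sq_le (by fun_prop) hg (by positivity) fun σ => ?_
    rw [ha, norm_mul, mul_pow, Complex.norm_real, Real.norm_of_nonneg hl0.le]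
    calc l ^ 2 * ‖β (l * σ)‖ ^ 2 ≤ l ^ 2 * (M ^ 2 * |l * σ|) := by gcongr; exact h.bound _
      _ = M ^ 2 * l ^ 3 * |σ| := by rw [abs_mul, abs_of_pos hl0]; ring
      _ ≤ M ^ 2 * (r₀⁻¹) ^ 3 * |σ| := by gcongr; exact hl.2
      _ = _ := by field_simp
  have hb2 : ∀ l ∈ Ioc (2 * r₀)⁻¹ r₀⁻¹,
      ∫⁻ x, ‖F' l x‖ₑ ^ 2 ≤ ENNReal.ofReal (4 * M ^ 2 / r₀) * I := by
    intro l hl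
    have hl0 : 0 < l := lt_trans (by positivity) hl.1
    rw [hF', hI]
    refine lintegral_multiplier_sq_le (by fun_prop) hg (by positivity) fun σ => ?_
    have h1 := h.bound (l * σ)
    have h2 := h.bound_deriv (l * σ)
    rw [ha']
    calc ‖β (l * σ) + (l * σ : ℝ) * β' (l * σ)‖ ^ 2
        ≤ (‖β (l * σ)‖ + ‖((l * σ : ℝ) : ℂ) * β' (l * σ)‖) ^ 2 := by
          gcongr; exact norm_add_le _ _
      _ ≤ 4 * (M ^ 2 * |l * σ|) := by
          nlinarith [sq_nonneg (‖β (l * σ)‖ - ‖((l * σ : ℝ) : ℂ) * β' (l * σ)‖)]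
      _ = 4 * M ^ 2 * l * |σ| := by rw [abs_mul, abs_of_pos hl0]; ring
      _ ≤ 4 * M ^ 2 * r₀⁻¹ * |σ| := by gcongr; exact hl.2
      _ = _ := by field_simp
  rw [← hI]
  clear hI hF hF' ha ha' had hac hac' hgi hgJ
  have hlen : r₀⁻¹ - (2 * r₀)⁻¹ = (2 * r₀)⁻¹ := by field_simp; norm_num
  calc ∫⁻ r in Icc r₀ (2 * r₀), ‖∫ s, β s * e (s * r ^ 2) * g (s * r)‖ₑ ^ 2
      ≤ ∫⁻ x in Icc r₀ (2 * r₀), ∫⁻ l in Ioc (2 * r₀)⁻¹ r₀⁻¹,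
        (ENNReal.ofReal (4 * r₀) * ‖F l x‖ₑ ^ 2 +
          ENNReal.ofReal (2 * r₀)⁻¹ * ‖F' l x‖ₑ ^ 2) := by
        refine setLIntegral_mono' measurableSet_Icc fun r hr' => ?_
        rw [hdiag r hr']
        have hr0 : 0 < r := hr.trans_le hr'.1
        have := enorm_sq_le_lintegral (hFd r).1 (hFd r).2 (a := (2 * r₀)⁻¹) (b := r₀⁻¹)
          (q := 2 * r₀) (x := r⁻¹) (by gcongr; linarith) (by positivity)
          ⟨inv_anti₀ hr0 hr'.2, inv_anti₀ hr hr'.1⟩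
        rw [hlen, inv_inv] at this
        convert! this using 6
        ring
    _ ≤ ∫⁻ x, ∫⁻ l in Ioc (2 * r₀)⁻¹ r₀⁻¹, (ENNReal.ofReal (4 * r₀) * ‖F l x‖ₑ ^ 2 +
          ENNReal.ofReal (2 * r₀)⁻¹ * ‖F' l x‖ₑ ^ 2) := setLIntegral_le_lintegral _ _
    _ = ∫⁻ l in Ioc (2 * r₀)⁻¹ r₀⁻¹, ∫⁻ x, (ENNReal.ofReal (4 * r₀) * ‖F l x‖ₑ ^ 2 +
          ENNReal.ofReal (2 * r₀)⁻¹ * ‖F' l x‖ₑ ^ 2) := by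
        apply lintegral_lintegral_swap
        exact (((hFm.enorm.pow_const 2).const_mul _).add
          ((hFm'.enorm.pow_const 2).const_mul _)).aemeasurable
    _ ≤ ∫⁻ l in Ioc (2 * r₀)⁻¹ r₀⁻¹, ENNReal.ofReal (6 * M ^ 2 / r₀ ^ 2) * I := by
        refine setLIntegral_mono' measurableSet_Ioc fun l hl => ?_
        have m1 : Measurable fun x => F l x := hFm.comp measurable_prodMk_right
        rw [lintegral_add_left ((m1.enorm.pow_const 2).const_mul _),
          lintegral_const_mul' _ _ ENNReal.ofReal_ne_top,
          lintegral_const_mul' _ _ ENNReal.ofReal_ne_top]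
        refine (add_le_add (mul_le_mul_right (hb1 l hl) _)
          (mul_le_mul_right (hb2 l hl) _)).trans_eq ?_
        rw [← mul_assoc, ← mul_assoc, ← add_mul, ← ENNReal.ofReal_mul (by positivity),
          ← ENNReal.ofReal_mul (by positivity), ← ENNReal.ofReal_add (by positivity)
          (by positivity)]
        congr 2
        field_simp; ring
    _ = _ := by
        rw [setLIntegral_const, Real.volume_Ioc, hlen, mul_right_comm,
          ← ENNReal.ofReal_mul (by positivity)]
        congr 2
        field_simp; ring

/-! ### The oscillatory integral in the plane -/

/-- The oscillatory integral `∫ β(s) e(s |y|²) F(s y) ds`, for `y ∈ ℝ²`. -/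
noncomputable def oscInt (β : ℝ → ℂ) (F : ℝ × ℝ → ℂ) (y : ℝ × ℝ) : ℂ :=
  ∫ s, β s * e (s * (y.1 ^ 2 + y.2 ^ 2)) * F (s * y.1, s * y.2)

/-- The annulus `r ≤ |y| ≤ 2r` in the plane. -/
def annulus (r : ℝ) : Set (ℝ × ℝ) :=
  {y | r ^ 2 ≤ y.1 ^ 2 + y.2 ^ 2 ∧ y.1 ^ 2 + y.2 ^ 2 ≤ (2 * r) ^ 2}

lemma measurableSet_annulus (r : ℝ) : MeasurableSet (annulus r) := by
  rw [annulus, ofPred_and]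
  exact (measurableSet_le (by fun_prop) (by fun_prop)).inter
    (measurableSet_le (by fun_prop) (by fun_prop))

/-- The disc `|y| ≤ E` in the plane. -/
def disc (E : ℝ) : Set (ℝ × ℝ) := {y | y.1 ^ 2 + y.2 ^ 2 ≤ E ^ 2}

lemma measurableSet_disc (E : ℝ) : MeasurableSet (disc E) :=
  measurableSet_le (by fun_prop) (by fun_prop)

/-- The point of the plane with polar coordinates `(r, θ)`; here `r` may be negative. -/
noncomputable def polarPt (r θ : ℝ) : ℝ × ℝ := (r * Real.cos θ, r * Real.sin θ)

lemma polarPt_sq (r θ : ℝ) : (polarPt r θ).1 ^ 2 + (polarPt r θ).2 ^ 2 = r ^ 2 := by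
  simp only [polarPt]
  linear_combination r ^ 2 * Real.sin_sq_add_cos_sq θ

lemma continuous_polarPt : Continuous fun p : ℝ × ℝ => polarPt p.1 p.2 := by
  unfold polarPt; fun_prop

lemma lintegral_eq_lintegral_polarPt {f : ℝ × ℝ → ℝ≥0∞} (hf : Measurable f) :
    ∫⁻ y, f y = ∫⁻ θ in Ioo (-Real.pi) Real.pi,
      ∫⁻ r in Ioi (0 : ℝ), ENNReal.ofReal r * f (polarPt r θ) := by
  rw [← lintegral_comp_polarCoord_symm, polarCoord_target, Measure.volume_eq_prod,
    ← Measure.prod_restrict, lintegral_prod_symm']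
  · rfl
  · exact (by fun_prop : Measurable fun p : ℝ × ℝ => ENNReal.ofReal p.1).mul
      (hf.comp continuous_polarCoord_symm.measurable)

/-- The rays `θ` and `θ + π` together make up a line through the origin. -/
lemma lintegral_line_eq {f : ℝ × ℝ → ℝ≥0∞} (hf : Measurable f) {E : ℝ} (hE : 0 ≤ E) (θ : ℝ) :
    ∫⁻ σ in Icc (-E) E, ENNReal.ofReal |σ| * f (polarPt σ θ) =
      (∫⁻ r in Ioi (0 : ℝ), ENNReal.ofReal r * (disc E).indicator f (polarPt r θ)) +
      ∫⁻ r in Ioi (0 : ℝ), ENNReal.ofReal r * (disc E).indicator f (-polarPt r θ) := by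
  obtain ⟨k, hk⟩ : ∃ k : ℝ → ℝ≥0∞, k = fun σ => ENNReal.ofReal |σ| *
    (disc E).indicator f (polarPt σ θ) := ⟨_, rfl⟩
  have hkm : Measurable k := by
    have := (hf.indicator (measurableSet_disc E)).comp
      (continuous_polarPt.comp (Continuous.prodMk_left θ)).measurable
    rw [hk]
    exact (by fun_prop : Measurable fun σ : ℝ => ENNReal.ofReal |σ|).mul this
  have e1 : ∫⁻ σ in Icc (-E) E, ENNReal.ofReal |σ| * f (polarPt σ θ) = ∫⁻ σ, k σ := by
    rw [← lintegral_indicator measurableSet_Icc]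
    refine lintegral_congr fun σ => ?_
    have : σ ∈ Icc (-E) E ↔ polarPt σ θ ∈ disc E := by
      rw [disc, mem_ofPred_eq, polarPt_sq, sq_le_sq, abs_of_nonneg hE, abs_le]; rfl
    by_cases hσ : σ ∈ Icc (-E) E
    · simp only [hk, indicator_of_mem hσ, indicator_of_mem (this.1 hσ)]
    · simp only [hk, indicator_of_notMem hσ, indicator_of_notMem (fun h' => hσ (this.2 h')),
        mul_zero]
  have e2 : ∫⁻ σ, k σ = (∫⁻ r in Ioi (0 : ℝ), k r) + ∫⁻ r in Ioi (0 : ℝ), k (-r) := by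
    rw [← lintegral_add_compl k (measurableSet_Ioi (a := (0 : ℝ))), compl_Ioi,
      setLIntegral_congr Iio_ae_eq_Iic.symm]
    congr 1
    have := (Measure.measurePreserving_neg (volume : Measure ℝ)).setLIntegral_comp_preimage
      (s := Iio 0) measurableSet_Iio hkm
    rw [← this]
    simp
  rw [e1, e2]
  congr 1
  · refine setLIntegral_congr_fun measurableSet_Ioi fun r (hr0 : 0 < r) => ?_
    simp only [hk, abs_of_pos hr0]
  · refine setLIntegral_congr_fun measurableSet_Ioi fun r (hr0 : 0 < r) => ?_
    simp only [hk, abs_neg, abs_of_pos hr0]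
    simp [polarPt]

lemma measurable_oscInt {β : ℝ → ℂ} {F : ℝ × ℝ → ℂ} (hβ : Continuous β) (hF : Continuous F) :
    Measurable (oscInt β F) := by
  refine (StronglyMeasurable.integral_prod_right (ν := volume) (f := fun (y : ℝ × ℝ) s =>
    β s * e (s * (y.1 ^ 2 + y.2 ^ 2)) * F (s * y.1, s * y.2)) ?_).measurable
  exact (Continuous.measurable (by unfold Function.uncurry; fun_prop)).stronglyMeasurable

lemma lintegral_oscInt_ray_le {S M r₀ : ℝ} {β β' : ℝ → ℂ} {F : ℝ × ℝ → ℂ}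
    (h : IsAmplitude S M β β') (hr : 0 < r₀) (hF : Continuous F) (θ : ℝ) :
    ∫⁻ r in Ioi (0 : ℝ), ENNReal.ofReal r *
      (annulus r₀).indicator (fun y => ‖oscInt β F y‖ₑ ^ 2) (polarPt r θ) ≤
      ENNReal.ofReal (6 * M ^ 2 / r₀ ^ 2) *
        ∫⁻ σ in Icc (-(2 * S * r₀)) (2 * S * r₀),
          ENNReal.ofReal |σ| * ‖F (polarPt σ θ)‖ₑ ^ 2 := by
  have hg : Continuous fun σ => F (polarPt σ θ) :=
    hF.comp (continuous_polarPt.comp (Continuous.prodMk_left θ))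
  obtain ⟨k, hk⟩ : ∃ k : ℝ → ℝ≥0∞, k = fun r =>
    ‖∫ s, β s * e (s * r ^ 2) * F (polarPt (s * r) θ)‖ₑ ^ 2 := ⟨_, rfl⟩
  have h1 : ∫⁻ r in Icc r₀ (2 * r₀), k r ≤ ENNReal.ofReal (3 * M ^ 2 / r₀ ^ 3) *
      ∫⁻ σ in Icc (-(2 * S * r₀)) (2 * S * r₀),
        ENNReal.ofReal |σ| * ‖F (polarPt σ θ)‖ₑ ^ 2 := by
    rw [hk]; exact lintegral_ray_sq_le (g := fun σ => F (polarPt σ θ)) h hr hg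
  have h2 : ∀ r ∈ Ioi (0 : ℝ), ENNReal.ofReal r *
      (annulus r₀).indicator (fun y => ‖oscInt β F y‖ₑ ^ 2) (polarPt r θ) ≤
        (Icc r₀ (2 * r₀)).indicator (fun r => ENNReal.ofReal (2 * r₀) * k r) r := by
    intro r (hr0 : 0 < r)
    by_cases hy : polarPt r θ ∈ annulus r₀
    · have hmem : r ∈ Icc r₀ (2 * r₀) := by
        obtain ⟨h1, h2⟩ := hy
        rw [polarPt_sq] at h1 h2
        exact ⟨(sq_le_sq₀ hr.le hr0.le).1 h1, (sq_le_sq₀ hr0.le (by positivity)).1 h2⟩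
      have : oscInt β F (polarPt r θ) =
          ∫ s, β s * e (s * r ^ 2) * F (polarPt (s * r) θ) := by
        rw [oscInt, polarPt_sq]
        simp only [polarPt, mul_assoc]
      rw [indicator_of_mem hy, indicator_of_mem hmem, this, hk]
      gcongr
      exact hmem.2
    · simp [indicator_of_notMem hy]
  refine (setLIntegral_mono' measurableSet_Ioi h2).trans ((setLIntegral_le_lintegral _ _).trans ?_)
  rw [lintegral_indicator measurableSet_Icc, lintegral_const_mul' _ _ ENNReal.ofReal_ne_top]
  refine (mul_le_mul_right h1 _).trans_eq ?_
  rw [← mul_assoc, ← ENNReal.ofReal_mul (by positivity)]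
  congr 2
  field_simp; ring

/-- The `L²` estimate for the oscillatory integral in the plane: in polar coordinates it is the
one-dimensional estimate along each ray. -/
theorem lintegral_oscInt_sq_le {S M r₀ : ℝ} {β β' : ℝ → ℂ} {F : ℝ × ℝ → ℂ}
    (h : IsAmplitude S M β β') (hr : 0 < r₀) (hF : Continuous F) :
    ∫⁻ y in annulus r₀, ‖oscInt β F y‖ₑ ^ 2 ≤
      ENNReal.ofReal (12 * M ^ 2 / r₀ ^ 2) * ∫⁻ y in disc (2 * S * r₀), ‖F y‖ₑ ^ 2 := by
  by_cases hS : 0 ≤ S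
  swap
  · have : ∀ s, β s = 0 := fun s => by_contra fun hs =>
      hS ((abs_nonneg _).trans (h.support s hs))
    simp [oscInt, this]
  obtain ⟨f, hf⟩ : ∃ f : ℝ × ℝ → ℝ≥0∞, f = fun y => ‖F y‖ₑ ^ 2 := ⟨_, rfl⟩
  have hfm : Measurable f := by rw [hf]; fun_prop
  have hfE := hfm.indicator (measurableSet_disc (2 * S * r₀))
  have hneg := (Measure.measurePreserving_neg (volume : Measure (ℝ × ℝ))).lintegral_comp hfE
  have hfE' := hfE.comp measurable_neg
  have h1 := lintegral_eq_lintegral_polarPt hfE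
  have h2 := lintegral_eq_lintegral_polarPt hfE'
  have hray := lintegral_oscInt_ray_le h hr hF
  simp only [← hf, fun σ θ => (congr_fun hf (polarPt σ θ)).symm] at hray ⊢
  rw [← lintegral_indicator (measurableSet_annulus r₀),
    ← lintegral_indicator (measurableSet_disc _), lintegral_eq_lintegral_polarPt
      (((measurable_oscInt h.continuous hF).enorm.pow_const 2).indicator
        (measurableSet_annulus r₀))]
  calc _ ≤ ∫⁻ θ in Ioo (-Real.pi) Real.pi, ENNReal.ofReal (6 * M ^ 2 / r₀ ^ 2) *
        ((∫⁻ r in Ioi (0 : ℝ), ENNReal.ofReal r *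
          (disc (2 * S * r₀)).indicator f (polarPt r θ)) +
        ∫⁻ r in Ioi (0 : ℝ), ENNReal.ofReal r *
          (disc (2 * S * r₀)).indicator f (-polarPt r θ)) :=
        lintegral_mono fun θ => (hray θ).trans_eq
          (by rw [lintegral_line_eq hfm (by positivity)])
    _ = ENNReal.ofReal (6 * M ^ 2 / r₀ ^ 2) * ((∫⁻ y, (disc (2 * S * r₀)).indicator f y) +
        ∫⁻ y, (disc (2 * S * r₀)).indicator f (-y)) := by
        rw [lintegral_const_mul' _ _ ENNReal.ofReal_ne_top, lintegral_add_left, h1]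
        · congr 2
          exact h2.symm
        refine Measurable.lintegral_prod_left' (f := fun p : ℝ × ℝ => ENNReal.ofReal p.1 *
          (disc (2 * S * r₀)).indicator f (polarPt p.1 p.2)) ?_
        exact (by fun_prop : Measurable fun p : ℝ × ℝ => ENNReal.ofReal p.1).mul
          (hfE.comp continuous_polarPt.measurable)
    _ = _ := by
        rw [hneg, ← two_mul, ← mul_assoc, ← ENNReal.ofReal_ofNat 2,
          ← ENNReal.ofReal_mul (by positivity)]
        congr 2
        ring

/-! ### Sampling at the integers, and Parseval on strips -/

namespace IsAmplitude

variable {S M : ℝ} {β β' : ℝ → ℂ}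

lemma support_deriv (h : IsAmplitude S M β β') (s : ℝ) (hs : β' s ≠ 0) : |s| ≤ S := by
  by_contra! hlt
  apply hs
  have h1 : β =ᶠ[nhds s] fun _ => 0 := by
    filter_upwards [(isOpen_lt continuous_const continuous_abs).mem_nhds hlt] with t ht
    by_contra hne
    exact absurd (h.support t hne) (not_le.2 ht)
  exact ((h.hasDerivAt s).congr_of_eventuallyEq h1.symm).unique (hasDerivAt_const s 0)

/-- Multiplication by `s` costs a factor of the size of the support. -/
lemma ofReal_mul (h : IsAmplitude S M β β') :
    IsAmplitude S (2 * S * M) (fun s => s * β s) (fun s => β s + s * β' s) where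
  hasDerivAt s := by
    have h1 : HasDerivAt (fun l : ℝ => (l : ℂ)) 1 s := Complex.ofRealCLM.hasDerivAt
    convert! h1.mul (h.hasDerivAt s) using 1
    ring
  continuous_deriv := by
    have := h.continuous
    have := h.continuous_deriv
    fun_prop
  support s hs := h.support s (right_ne_zero_of_mul hs)
  bound s := by
    by_cases hs : β s = 0
    · simp only [hs, mul_zero, norm_zero, zero_pow two_ne_zero]; positivity
    have h1 := h.support s hs
    have h2 : 0 ≤ S := (abs_nonneg s).trans h1
    rw [norm_mul, mul_pow, Complex.norm_real, Real.norm_eq_abs]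
    calc |s| ^ 2 * ‖β s‖ ^ 2 ≤ S ^ 2 * (M ^ 2 * |s|) := by gcongr; exact h.bound s
      _ ≤ 4 * (S ^ 2 * (M ^ 2 * |s|)) := by
        have : 0 ≤ S ^ 2 * (M ^ 2 * |s|) := by positivity
        linarith
      _ = _ := by ring
  bound_deriv s := by
    by_cases hs : |s| ≤ S
    · have h2 : 0 ≤ S := (abs_nonneg s).trans hs
      have h3 := h.bound s
      have h4 := h.bound_deriv s
      rw [norm_mul, mul_pow, Complex.norm_real, Real.norm_eq_abs]
      calc |s| ^ 2 * ‖β s + s * β' s‖ ^ 2 ≤ S ^ 2 * (‖β s‖ + ‖s * β' s‖) ^ 2 := by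
            gcongr; exact norm_add_le _ _
        _ ≤ S ^ 2 * (4 * (M ^ 2 * |s|)) := by
            gcongr
            nlinarith [sq_nonneg (‖β s‖ - ‖s * β' s‖)]
        _ = _ := by ring
    · have h1 : β s = 0 := by_contra fun h' => hs (h.support s h')
      have h2 : β' s = 0 := by_contra fun h' => hs (h.support_deriv s h')
      simp only [h1, h2, mul_zero, add_zero, norm_zero, zero_pow two_ne_zero]; positivity

end IsAmplitude

/-- The derivative in `y₂` of the oscillatory integral is made of two oscillatory integrals with
the amplitude `s β(s)`. -/
theorem hasDerivAt_oscInt {S M : ℝ} {β β' : ℝ → ℂ} {F F₂ : ℝ × ℝ → ℂ} (h : IsAmplitude S M β β')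
    (hF : Continuous F) (hF₂ : Continuous F₂)
    (hd : ∀ x t, HasDerivAt (fun t => F (x, t)) (F₂ (x, t)) t) (x : ℝ) :
    (∀ t : ℝ, HasDerivAt (fun t => oscInt β F (x, t))
      (4 * Real.pi * Complex.I * t * oscInt (fun s => s * β s) F (x, t) +
        oscInt (fun s => s * β s) F₂ (x, t)) t) ∧
    Continuous fun t : ℝ => 4 * Real.pi * Complex.I * t * oscInt (fun s => s * β s) F (x, t) +
        oscInt (fun s => s * β s) F₂ (x, t) := by
  obtain ⟨φ, hφ⟩ : ∃ φ : ℝ → ℝ → ℂ,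
    φ = fun t s => e (s * (x ^ 2 + t ^ 2)) * F (s * x, s * t) := ⟨_, rfl⟩
  obtain ⟨φ', hφ'⟩ : ∃ φ' : ℝ → ℝ → ℂ, φ' = fun t s =>
    4 * Real.pi * Complex.I * t * (s * e (s * (x ^ 2 + t ^ 2)) * F (s * x, s * t)) +
      s * e (s * (x ^ 2 + t ^ 2)) * F₂ (s * x, s * t) := ⟨_, rfl⟩
  have hc : Continuous fun p : ℝ × ℝ => φ p.1 p.2 := by rw [hφ]; fun_prop
  have hc' : Continuous fun p : ℝ × ℝ => φ' p.1 p.2 := by rw [hφ']; fun_prop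
  have hdφ : ∀ t s, HasDerivAt (fun t => φ t s) (φ' t s) t := by
    intro t s
    have h1 : HasDerivAt (fun t : ℝ => s * (x ^ 2 + t ^ 2)) (s * (2 * t)) t := by
      have := ((hasDerivAt_pow 2 t).const_add (x ^ 2)).const_mul s
      simpa using this
    have h2 := (hasDerivAt_e (s * (x ^ 2 + t ^ 2))).scomp t h1
    have h3 : HasDerivAt (fun t : ℝ => F (s * x, s * t)) (s • F₂ (s * x, s * t)) t := by
      have h4 : HasDerivAt (fun t : ℝ => s * t) s t := by
        simpa using (hasDerivAt_id t).const_mul s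
      exact (hd (s * x) (s * t)).scomp t h4
    rw [hφ, hφ']
    convert! h2.mul h3 using 1
    simp only [Complex.real_smul, Function.comp_apply]
    push_cast; ring
  have hD : ∀ t : ℝ, ∫ s, φ' t s * β s =
      4 * Real.pi * Complex.I * t * oscInt (fun s => s * β s) F (x, t) +
        oscInt (fun s => s * β s) F₂ (x, t) := by
    intro t
    have hβs := h.ofReal_mul
    have hint : ∀ {G : ℝ × ℝ → ℂ}, Continuous G → Integrable fun s : ℝ =>
        s * β s * e (s * (x ^ 2 + t ^ 2)) * G (s * x, s * t) := by
      intro G hG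
      have := hβs.continuous
      refine Continuous.integrable_of_hasCompactSupport (by fun_prop) ?_
      refine HasCompactSupport.intro (isCompact_Icc (a := -S) (b := S)) fun s hs => ?_
      have : β s = 0 := by_contra fun h' => hs (abs_le.1 (h.support s h'))
      simp [this]
    rw [oscInt, oscInt, ← integral_const_mul, ← integral_add ((hint hF).const_mul _) (hint hF₂)]
    refine integral_congr_ae (.of_forall fun s => ?_)
    simp only [hφ']; ring
  have key := hasDerivAt_integral_mul h.integrable h.support hc hc' hdφ
  have hU : (fun t => ∫ s, φ t s * β s) = fun t => oscInt β F (x, t) := by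
    funext t
    rw [oscInt]
    refine integral_congr_ae (.of_forall fun s => ?_)
    simp only [hφ]; ring
  simp only [hU, hD] at key
  exact key

/-- Sampling: the sum over the integers `n` of `‖u(·, n)‖²` is controlled by the `L²` norms in the
plane of `u` and of its derivative in the second variable. -/
theorem lintegral_sample_le {u D : ℝ × ℝ → ℂ} (hu : Measurable u) (hD : Measurable D)
    (hd : ∀ x t, HasDerivAt (fun t => u (x, t)) (D (x, t)) t)
    (hc : ∀ x, Continuous fun t => D (x, t)) {q : ℝ} (hq : 0 < q) {P : Set (ℝ × ℝ)}
    (hP : MeasurableSet P) {Q : Set (ℝ × ℤ)} (hQ : MeasurableSet Q)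
    (hQP : ∀ y ∈ Q, ∀ t ∈ Icc (y.2 : ℝ) (y.2 + 1), (y.1, t) ∈ P) :
    ∫⁻ y in Q, ‖u (y.1, y.2)‖ₑ ^ 2 ∂μ ≤
      ENNReal.ofReal (1 + q) * (∫⁻ y in P, ‖u y‖ₑ ^ 2) +
        ENNReal.ofReal q⁻¹ * ∫⁻ y in P, ‖D y‖ₑ ^ 2 := by
  obtain ⟨ψ, hψ⟩ : ∃ ψ : ℝ × ℝ → ℝ≥0∞, ψ = P.indicator fun y =>
    ENNReal.ofReal (1 + q) * ‖u y‖ₑ ^ 2 + ENNReal.ofReal q⁻¹ * ‖D y‖ₑ ^ 2 := ⟨_, rfl⟩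
  have hm1 : Measurable fun y => ENNReal.ofReal (1 + q) * ‖u y‖ₑ ^ 2 := by fun_prop
  have hm2 : Measurable fun y => ENNReal.ofReal q⁻¹ * ‖D y‖ₑ ^ 2 := by fun_prop
  have hψm : Measurable ψ := by
    rw [hψ]; exact (hm1.add hm2).indicator hP
  have hpt : ∀ y ∈ Q, ‖u (y.1, y.2)‖ₑ ^ 2 ≤ ∫⁻ t in Ioc (y.2 : ℝ) (y.2 + 1), ψ (y.1, t) := by
    intro y hy
    have h1 := enorm_sq_le_lintegral (hd y.1) (hc y.1) (a := (y.2 : ℝ)) (b := y.2 + 1)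
      (lt_add_one _) hq (left_mem_Icc.2 (le_add_of_nonneg_right zero_le_one))
    rw [add_sub_cancel_left, inv_one] at h1
    refine h1.trans_eq (setLIntegral_congr_fun measurableSet_Ioc fun t ht => ?_)
    rw [hψ, indicator_of_mem (hQP y hy t (Ioc_subset_Icc_self ht))]
  calc ∫⁻ y in Q, ‖u (y.1, y.2)‖ₑ ^ 2 ∂μ
      ≤ ∫⁻ y in Q, (∫⁻ t in Ioc (y.2 : ℝ) (y.2 + 1), ψ (y.1, t)) ∂μ := setLIntegral_mono' hQ hpt
    _ ≤ ∫⁻ y : ℝ × ℤ, (∫⁻ t in Ioc (y.2 : ℝ) (y.2 + 1), ψ (y.1, t)) ∂μ :=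
        setLIntegral_le_lintegral _ _
    _ ≤ ∫⁻ x, ∫⁻ n : ℤ, (∫⁻ t in Ioc (n : ℝ) (n + 1), ψ (x, t)) ∂Measure.count := by
        rw [μ]; exact lintegral_prod_le _
    _ = ∫⁻ x, ∫⁻ t, ψ (x, t) := by
        refine lintegral_congr fun x => ?_
        rw [lintegral_count, ← lintegral_iUnion (fun _ => measurableSet_Ioc)
          (by simpa using! pairwise_disjoint_Ioc_intCast ℝ), iUnion_Ioc_intCast,
          setLIntegral_univ]
    _ = ∫⁻ y, ψ y := by
        rw [Measure.volume_eq_prod, lintegral_prod _ hψm.aemeasurable]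
    _ = _ := by
        rw [hψ, lintegral_indicator hP, lintegral_add_left hm1,
          lintegral_const_mul' _ _ ENNReal.ofReal_ne_top,
          lintegral_const_mul' _ _ ENNReal.ofReal_ne_top]

lemma e_intCast (n : ℤ) : e n = 1 := by
  rw [e, Complex.exp_eq_one_iff]
  exact ⟨n, by push_cast; ring⟩

lemma conj_e (x : ℝ) : (starRingEnd ℂ) (e x) = e (-x) := by
  rw [e, e, ← Complex.exp_conj]
  congr 1
  simp [map_ofNat]

lemma integral_e_int_mul (n : ℤ) (a : ℝ) :
    ∫ t in a..a + 1, e (n * t) = if n = 0 then 1 else 0 := by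
  split_ifs with h
  · simp [h, e_zero]
  · have hn : (2 * Real.pi * Complex.I * n : ℂ) ≠ 0 := by
      simp [Real.pi_ne_zero, h]
    have hd : ∀ t : ℝ, HasDerivAt (fun t : ℝ => e (n * t) / (2 * Real.pi * Complex.I * n))
        (e (n * t)) t := by
      intro t
      have h1 : HasDerivAt (fun t : ℝ => n * t) (n : ℝ) t := by
        simpa using (hasDerivAt_id t).const_mul (n : ℝ)
      convert! ((hasDerivAt_e (n * t)).scomp t h1).div_const _ using 1
      rw [Complex.real_smul, eq_div_iff hn]
      push_cast; ring
    rw [intervalIntegral.integral_eq_sub_of_hasDerivAt (fun t _ => hd t)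
      (Continuous.intervalIntegrable (by fun_prop) _ _), mul_add, mul_one, e_add, e_intCast,
      mul_one, sub_self]

/-- Parseval's identity for a trigonometric polynomial, over any interval of length one. -/
theorem lintegral_trigPoly_sq (N : Finset ℤ) (c : ℤ → ℂ) (a : ℝ) :
    ∫⁻ t in Ioc a (a + 1), ‖∑ n ∈ N, e (-(n * t)) * c n‖ₑ ^ 2 = ∑ n ∈ N, ‖c n‖ₑ ^ 2 := by
  obtain ⟨f, hf⟩ : ∃ f : ℝ → ℂ, f = fun t => ∑ n ∈ N, e (-(n * t)) * c n := ⟨_, rfl⟩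
  have hfc : Continuous f := by rw [hf]; fun_prop
  have h1 : ∫ t in a..a + 1, ‖f t‖ ^ 2 = ∑ n ∈ N, ‖c n‖ ^ 2 := by
    have h2 : ∀ t, ((‖f t‖ ^ 2 : ℝ) : ℂ) =
        ∑ n ∈ N, ∑ m ∈ N, c n * (starRingEnd ℂ) (c m) * e ((m - n : ℤ) * t) := by
      intro t
      rw [Complex.ofReal_pow, ← Complex.mul_conj', hf, map_sum, Finset.sum_mul_sum]
      refine Finset.sum_congr rfl fun n _ => Finset.sum_congr rfl fun m _ => ?_
      have : ((m - n : ℤ) : ℝ) * t = -(n * t) + m * t := by push_cast; ring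
      rw [this, e_add, map_mul, conj_e, neg_neg]
      ring
    have h3 : ((∫ t in a..a + 1, ‖f t‖ ^ 2 : ℝ) : ℂ) = ((∑ n ∈ N, ‖c n‖ ^ 2 : ℝ) : ℂ) := by
      rw [← intervalIntegral.integral_ofReal]
      simp_rw [h2]
      rw [intervalIntegral.integral_finsetSum fun n _ =>
        Continuous.intervalIntegrable (by fun_prop) _ _, Complex.ofReal_sum]
      refine Finset.sum_congr rfl fun n hn => ?_
      rw [intervalIntegral.integral_finsetSum fun n _ =>
        Continuous.intervalIntegrable (by fun_prop) _ _]
      simp_rw [intervalIntegral.integral_const_mul, integral_e_int_mul, sub_eq_zero]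
      simp [hn, Complex.mul_conj']
    exact_mod_cast h3
  rw [intervalIntegral.integral_of_le (by linarith)] at h1
  have h4 := ofReal_integral_eq_lintegral_ofReal (μ := volume.restrict (Ioc a (a + 1)))
    (f := fun t => ‖f t‖ ^ 2)
    ((Continuous.integrableOn_Icc (by fun_prop)).mono_set Ioc_subset_Icc_self)
    (.of_forall fun t => by positivity)
  rw [h1, ENNReal.ofReal_sum_of_nonneg fun n _ => by positivity] at h4
  simp only [ENNReal.ofReal_pow (norm_nonneg _), ofReal_norm] at h4
  rw [h4, hf]

/-- Over a bounded strip, the `L²` norm of the Fourier transform of a function on `ℝ × ℤ` is that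
of the function, up to the number of periods that meet the strip. -/
theorem lintegral_disc_fourier_sq_le {N : Finset ℤ} {h : ℤ → ℝ → ℂ}
    (h1 : ∀ n ∈ N, Integrable (h n)) (h2 : ∀ n ∈ N, MemLp (h n) 2) {E : ℝ} (hE : 0 ≤ E) :
    ∫⁻ y in disc E, ‖∑ n ∈ N, e (-(n * y.2)) * 𝓕 (h n) y.1‖ₑ ^ 2 ≤
      ENNReal.ofReal (2 * E + 1) * ∑ n ∈ N, ∫⁻ x, ‖h n x‖ₑ ^ 2 := by
  have hc : ∀ n ∈ N, Continuous (𝓕 (h n)) := fun n hn =>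
    VectorFourier.fourierIntegral_continuous Real.continuous_fourierChar (by fun_prop) (h1 n hn)
  have hstrip : ∀ c : ℤ → ℂ, ∫⁻ t in Ioc (-E) E, ‖∑ n ∈ N, e (-(n * t)) * c n‖ₑ ^ 2 ≤
      ENNReal.ofReal (2 * E + 1) * ∑ n ∈ N, ‖c n‖ₑ ^ 2 := by
    intro c
    obtain ⟨m, hm⟩ : ∃ m, m = ⌈2 * E⌉₊ := ⟨_, rfl⟩
    have hcov : Ioc (-E) E ⊆ ⋃ i : Fin m, Ioc (-E + (i : ℕ)) (-E + (i : ℕ) + 1) := by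
      intro t ht
      have h3 : 0 < t + E := by linarith [ht.1]
      have h4 : 0 < ⌈t + E⌉₊ := Nat.ceil_pos.2 h3
      have h5 : ((⌈t + E⌉₊ - 1 : ℕ) : ℝ) = ⌈t + E⌉₊ - 1 := by
        rw [Nat.cast_sub h4, Nat.cast_one]
      have h6 : ⌈t + E⌉₊ ≤ m := hm ▸ Nat.ceil_mono (by linarith [ht.2])
      refine mem_iUnion.2 ⟨⟨⌈t + E⌉₊ - 1, by omega⟩, ?_, ?_⟩
      · rw [h5]; linarith [Nat.ceil_lt_add_one h3.le]
      · rw [h5]; linarith [Nat.le_ceil (t + E)]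
    calc _ ≤ ∫⁻ t in ⋃ i : Fin m, Ioc (-E + (i : ℕ)) (-E + (i : ℕ) + 1),
          ‖∑ n ∈ N, e (-(n * t)) * c n‖ₑ ^ 2 := lintegral_mono_set hcov
      _ ≤ ∑' i : Fin m, ∫⁻ t in Ioc (-E + (i : ℕ)) (-E + (i : ℕ) + 1),
          ‖∑ n ∈ N, e (-(n * t)) * c n‖ₑ ^ 2 := lintegral_iUnion_le _ _
      _ = (m : ℝ≥0∞) * ∑ n ∈ N, ‖c n‖ₑ ^ 2 := by
          simp only [lintegral_trigPoly_sq, tsum_fintype, Finset.sum_const, Finset.card_univ,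
            Fintype.card_fin, nsmul_eq_mul]
      _ ≤ _ := by
          gcongr
          rw [← ENNReal.ofReal_natCast]
          apply ENNReal.ofReal_le_ofReal
          rw [hm]
          exact (Nat.ceil_lt_add_one (by positivity)).le
  have hsub : disc E ⊆ univ ×ˢ Icc (-E) E := by
    intro y (hy : y.1 ^ 2 + y.2 ^ 2 ≤ E ^ 2)
    refine ⟨trivial, abs_le.1 (abs_le_of_sq_le_sq (by nlinarith [sq_nonneg y.1]) hE)⟩
  have hcc : Continuous fun y : ℝ × ℝ => ∑ n ∈ N, e (-(n * y.2)) * 𝓕 (h n) y.1 := by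
    refine continuous_finsetSum _ fun n hn => ?_
    have := hc n hn
    fun_prop
  calc _ ≤ ∫⁻ y in univ ×ˢ Icc (-E) E, ‖∑ n ∈ N, e (-(n * y.2)) * 𝓕 (h n) y.1‖ₑ ^ 2 :=
        lintegral_mono_set hsub
    _ = ∫⁻ x, ∫⁻ t in Icc (-E) E, ‖∑ n ∈ N, e (-(n * t)) * 𝓕 (h n) x‖ₑ ^ 2 := by
        rw [Measure.volume_eq_prod, ← Measure.prod_restrict, Measure.restrict_univ,
          lintegral_prod _ (by fun_prop)]
    _ ≤ ∫⁻ x, ENNReal.ofReal (2 * E + 1) * ∑ n ∈ N, ‖𝓕 (h n) x‖ₑ ^ 2 := by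
        refine lintegral_mono fun x => ?_
        rw [setLIntegral_congr Ioc_ae_eq_Icc.symm]
        exact hstrip fun n => 𝓕 (h n) x
    _ = _ := by
        rw [lintegral_const_mul' _ _ ENNReal.ofReal_ne_top, lintegral_finsetSum']
        · congr 1
          exact Finset.sum_congr rfl fun n hn => lintegral_fourier_sq (h1 n hn) (h2 n hn)
        · intro n hn
          have := (hc n hn).measurable
          fun_prop

/-! ### The oscillatory integral on the lattice -/

lemma enorm_add_sq_le (a b : ℂ) : ‖a + b‖ₑ ^ 2 ≤ 2 * (‖a‖ₑ ^ 2 + ‖b‖ₑ ^ 2) := by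
  have h : ‖a + b‖ ^ 2 ≤ 2 * (‖a‖ ^ 2 + ‖b‖ ^ 2) := by
    have := norm_add_le a b
    nlinarith [norm_nonneg (a + b), sq_nonneg (‖a‖ - ‖b‖)]
  refine (enorm_sq_le_ofReal h).trans_eq ?_
  rw [ENNReal.ofReal_mul (by positivity), ENNReal.ofReal_add (by positivity) (by positivity),
    ENNReal.ofReal_pow (norm_nonneg _), ENNReal.ofReal_pow (norm_nonneg _), ofReal_norm,
    ofReal_norm, ENNReal.ofReal_ofNat]

/-- The Fourier transform on `ℝ × ℤ` of the function with slices `h n`, for `n` in the finite set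
`N`, and `0` for the other integers. -/
noncomputable def fourierSum (N : Finset ℤ) (h : ℤ → ℝ → ℂ) (y : ℝ × ℝ) : ℂ :=
  ∑ n ∈ N, e (-(n * y.2)) * 𝓕 (h n) y.1

lemma continuous_fourierSum {N : Finset ℤ} {h : ℤ → ℝ → ℂ} (h1 : ∀ n ∈ N, Integrable (h n)) :
    Continuous (fourierSum N h) := by
  unfold fourierSum
  refine continuous_finsetSum _ fun n hn => ?_
  have : Continuous (𝓕 (h n)) :=
    VectorFourier.fourierIntegral_continuous Real.continuous_fourierChar (by fun_prop) (h1 n hn)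
  fun_prop

lemma hasDerivAt_fourierSum (N : Finset ℤ) (h : ℤ → ℝ → ℂ) (x t : ℝ) :
    HasDerivAt (fun t => fourierSum N h (x, t))
      (fourierSum N (fun n x => (-2 * Real.pi * Complex.I * n) * h n x) (x, t)) t := by
  unfold fourierSum
  refine HasDerivAt.fun_sum fun n _ => ?_
  have h1 : HasDerivAt (fun t : ℝ => -(n * t)) (-(n : ℝ)) t := by
    simpa using! ((hasDerivAt_id t).const_mul (n : ℝ)).neg
  convert! ((hasDerivAt_e (-(n * t))).scomp t h1).mul_const (𝓕 (h n) x) using 1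
  rw [fourier_eq_integral_e, fourier_eq_integral_e, Complex.real_smul]
  have : ∀ v, e (-(v * x)) * (-2 * Real.pi * Complex.I * n * h n v) =
      (-2 * Real.pi * Complex.I * n) * (e (-(v * x)) * h n v) := fun v => by ring
  simp_rw [this, integral_const_mul]
  push_cast; ring

lemma lintegral_oscInt_fourierSum_le {S M r₀ R : ℝ} {β β' : ℝ → ℂ} {N : Finset ℤ}
    {h : ℤ → ℝ → ℂ} (hβ : IsAmplitude S M β β') (hr : 0 < r₀) (hR : 1 ≤ R) (hSR : S * r₀ ≤ R)
    (h1 : ∀ n ∈ N, Integrable (h n)) (h2 : ∀ n ∈ N, MemLp (h n) 2) :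
    ∫⁻ y in annulus r₀, ‖oscInt β (fourierSum N h) y‖ₑ ^ 2 ≤
      ENNReal.ofReal (60 * M ^ 2 * R / r₀ ^ 2) * ∑ n ∈ N, ∫⁻ x, ‖h n x‖ₑ ^ 2 := by
  by_cases hS : 0 ≤ S
  swap
  · have : ∀ s, β s = 0 := fun s => by_contra fun hs =>
      hS ((abs_nonneg _).trans (hβ.support s hs))
    simp [oscInt, this]
  refine (lintegral_oscInt_sq_le hβ hr (continuous_fourierSum h1)).trans ?_
  unfold fourierSum
  refine (mul_le_mul_right (lintegral_disc_fourier_sq_le h1 h2 (by positivity)) _).trans ?_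
  rw [← mul_assoc, ← ENNReal.ofReal_mul (by positivity)]
  gcongr
  calc 12 * M ^ 2 / r₀ ^ 2 * (2 * (2 * S * r₀) + 1) ≤ 12 * M ^ 2 / r₀ ^ 2 * (5 * R) := by
        gcongr; linarith
    _ = _ := by ring

/-- The `L²` estimate on `ℝ × ℤ` for the oscillatory integral. The size `R` of the annulus in units
of the box length appears in three places, which balance: the planar estimate gains a factor `R`
(in `L²` norm), and both the number of periods of the Fourier transform on `ℝ × ℤ` and the loss
from restricting to integer points are of order `R` (for the squared norms). -/
theorem lintegral_sample_oscInt_le {S M r₀ R : ℝ} {β β' : ℝ → ℂ} {N : Finset ℤ}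
    {h : ℤ → ℝ → ℂ} (hβ : IsAmplitude S M β β') (hr : 0 < r₀) (hR : 1 ≤ R) (hS : 0 ≤ S)
    (hSR : S * r₀ ≤ R) (h1 : ∀ n ∈ N, Integrable (h n)) (h2 : ∀ n ∈ N, MemLp (h n) 2)
    (hN : ∀ n ∈ N, |(n : ℝ)| ≤ 2 * r₀) {Q : Set (ℝ × ℤ)} (hQ : MeasurableSet Q)
    (hQP : ∀ y ∈ Q, ∀ t ∈ Icc (y.2 : ℝ) (y.2 + 1), (y.1, t) ∈ annulus r₀) :
    ∫⁻ y in Q, ‖oscInt β (fourierSum N h) (y.1, y.2)‖ₑ ^ 2 ∂μ ≤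
      ENNReal.ofReal (400000 * M ^ 2 * R ^ 2 / r₀ ^ 2) * ∑ n ∈ N, ∫⁻ x, ‖h n x‖ₑ ^ 2 := by
  obtain ⟨k, hk⟩ : ∃ k : ℤ → ℝ → ℂ, k = fun n x => (-2 * Real.pi * Complex.I * n) * h n x :=
    ⟨_, rfl⟩
  obtain ⟨I, hI⟩ : ∃ I, I = ∑ n ∈ N, ∫⁻ x, ‖h n x‖ₑ ^ 2 := ⟨_, rfl⟩
  have hk1 : ∀ n ∈ N, Integrable (k n) := fun n hn => by
    rw [hk]; exact (h1 n hn).const_mul _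
  have hk2 : ∀ n ∈ N, MemLp (k n) 2 := fun n hn => by
    rw [hk]; exact (h2 n hn).const_mul _
  have hβs := hβ.ofReal_mul
  have hF := continuous_fourierSum h1
  have hK := continuous_fourierSum hk1
  have hmU := measurable_oscInt hβ.continuous hF
  have hmU1 := measurable_oscInt hβs.continuous hF
  have hmU2 := measurable_oscInt hβs.continuous hK
  have hd := hasDerivAt_oscInt hβ hF hK (fun x t => by rw [hk]; exact hasDerivAt_fourierSum N h x t)
  have hkI : ∑ n ∈ N, ∫⁻ x, ‖k n x‖ₑ ^ 2 ≤ ENNReal.ofReal (160 * r₀ ^ 2) * I := by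
    rw [hI, Finset.mul_sum]
    refine Finset.sum_le_sum fun n hn => ?_
    rw [← lintegral_const_mul' _ _ ENNReal.ofReal_ne_top]
    refine lintegral_mono fun x => ?_
    rw [hk, enorm_mul, mul_pow]
    gcongr
    apply enorm_sq_le_ofReal
    have h3 : ‖(-2 * Real.pi * Complex.I * n : ℂ)‖ = 2 * Real.pi * |(n : ℝ)| := by
      simp [abs_of_pos Real.pi_pos]
    rw [h3]
    calc (2 * Real.pi * |(n : ℝ)|) ^ 2 ≤ (2 * Real.pi * (2 * r₀)) ^ 2 := by
          gcongr; exact hN n hn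
      _ = 16 * Real.pi ^ 2 * r₀ ^ 2 := by ring
      _ ≤ 16 * 10 * r₀ ^ 2 := by
          gcongr
          nlinarith [Real.pi_lt_d2, Real.pi_pos]
      _ = _ := by ring
  have e0 := lintegral_oscInt_fourierSum_le hβ hr hR hSR h1 h2
  have e1 := lintegral_oscInt_fourierSum_le hβs hr hR hSR h1 h2
  have e2 := (lintegral_oscInt_fourierSum_le hβs hr hR hSR hk1 hk2).trans
    (mul_le_mul_right hkI _)
  rw [← hI] at e0 e1 ⊢
  rw [← mul_assoc, ← ENNReal.ofReal_mul (by positivity)] at e2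
  obtain ⟨U1, hU1⟩ : ∃ U1, U1 = oscInt (fun s => s * β s) (fourierSum N h) := ⟨_, rfl⟩
  obtain ⟨U2, hU2⟩ : ∃ U2, U2 = oscInt (fun s => s * β s) (fourierSum N k) := ⟨_, rfl⟩
  simp only [← hU1, ← hU2] at e1 e2 hmU1 hmU2 hd
  have hD : Measurable fun y : ℝ × ℝ => 4 * Real.pi * Complex.I * y.2 * U1 y + U2 y := by
    fun_prop
  have hsamp := lintegral_sample_le hmU hD (fun x => (hd x).1) (fun x => (hd x).2)
    (zero_lt_one.trans_le hR) (measurableSet_annulus r₀) hQ hQP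
  have hDle : ∫⁻ y in annulus r₀, ‖4 * Real.pi * Complex.I * y.2 * U1 y + U2 y‖ₑ ^ 2 ≤
      2 * (ENNReal.ofReal (640 * r₀ ^ 2) * (∫⁻ y in annulus r₀, ‖U1 y‖ₑ ^ 2) +
        ∫⁻ y in annulus r₀, ‖U2 y‖ₑ ^ 2) := by
    rw [← lintegral_const_mul' _ _ ENNReal.ofReal_ne_top, ← lintegral_add_left (by fun_prop),
      ← lintegral_const_mul' _ _ ENNReal.ofNat_ne_top]
    refine setLIntegral_mono' (measurableSet_annulus r₀) fun y hy => ?_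
    refine (enorm_add_sq_le _ _).trans ?_
    gcongr
    rw [enorm_mul, mul_pow]
    gcongr
    apply enorm_sq_le_ofReal
    have h3 : ‖(4 * Real.pi * Complex.I * y.2 : ℂ)‖ ^ 2 = 16 * Real.pi ^ 2 * y.2 ^ 2 := by
      rw [norm_mul, norm_mul, norm_mul, Complex.norm_I, Complex.norm_real, Complex.norm_real,
        mul_one, mul_pow, mul_pow, Real.norm_eq_abs, Real.norm_eq_abs, sq_abs, sq_abs]
      norm_num
    rw [h3]
    have h4 : y.2 ^ 2 ≤ (2 * r₀) ^ 2 := by linarith [hy.2, sq_nonneg y.1]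
    have h5 : Real.pi ^ 2 ≤ 10 := by nlinarith [Real.pi_lt_d2, Real.pi_pos]
    calc 16 * Real.pi ^ 2 * y.2 ^ 2 ≤ 16 * 10 * (2 * r₀) ^ 2 := by
          rw [mul_assoc, mul_assoc]
          gcongr
      _ = _ := by ring
  have hS2 : S ^ 2 ≤ R ^ 2 / r₀ ^ 2 := by
    rw [← div_pow]
    gcongr
    rwa [le_div_iff₀ hr]
  have hR0 : 0 < R := zero_lt_one.trans_le hR
  calc _ ≤ ENNReal.ofReal (1 + R) * (ENNReal.ofReal (60 * M ^ 2 * R / r₀ ^ 2) * I) +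
        ENNReal.ofReal R⁻¹ * (2 * (ENNReal.ofReal (640 * r₀ ^ 2) *
          (ENNReal.ofReal (60 * (2 * S * M) ^ 2 * R / r₀ ^ 2) * I) +
          ENNReal.ofReal (60 * (2 * S * M) ^ 2 * R / r₀ ^ 2 * (160 * r₀ ^ 2)) * I)) := by
        refine hsamp.trans ?_
        gcongr
        refine hDle.trans ?_
        gcongr
    _ = ENNReal.ofReal ((1 + R) * (60 * M ^ 2 * R / r₀ ^ 2) + R⁻¹ * (2 * (640 * r₀ ^ 2 *
          (60 * (2 * S * M) ^ 2 * R / r₀ ^ 2) +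
            60 * (2 * S * M) ^ 2 * R / r₀ ^ 2 * (160 * r₀ ^ 2)))) * I := by
        rw [ENNReal.ofReal_add (p := (1 + R) * _) (by positivity) (by positivity),
          ENNReal.ofReal_mul (p := 1 + R) (by positivity),
          ENNReal.ofReal_mul (p := R⁻¹) (by positivity),
          ENNReal.ofReal_mul (p := 2) (by positivity),
          ENNReal.ofReal_add (p := 640 * r₀ ^ 2 * _) (by positivity) (by positivity),
          ENNReal.ofReal_mul (p := 640 * r₀ ^ 2) (by positivity), ENNReal.ofReal_ofNat 2]
        ring
    _ ≤ _ := by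
        gcongr
        have h3 : R⁻¹ * (2 * (640 * r₀ ^ 2 * (60 * (2 * S * M) ^ 2 * R / r₀ ^ 2) +
            60 * (2 * S * M) ^ 2 * R / r₀ ^ 2 * (160 * r₀ ^ 2))) = 384000 * M ^ 2 * S ^ 2 := by
          field_simp; ring
        rw [h3]
        calc (1 + R) * (60 * M ^ 2 * R / r₀ ^ 2) + 384000 * M ^ 2 * S ^ 2
            ≤ (R + R) * (60 * M ^ 2 * R / r₀ ^ 2) + 384000 * M ^ 2 * (R ^ 2 / r₀ ^ 2) := by
              gcongr
          _ = 384120 * M ^ 2 * R ^ 2 / r₀ ^ 2 := by ring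
          _ ≤ _ := by gcongr; norm_num

/-! ### Low and high frequencies of a symbol -/

/-- The weight `(1 + s²)⁻²`, which singles out the low frequencies `|s| ≲ 1`. -/
noncomputable def lowWeight (s : ℝ) : ℝ := ((1 + s ^ 2) ^ 2)⁻¹

@[fun_prop]
lemma continuous_lowWeight : Continuous lowWeight := by
  unfold lowWeight
  exact Continuous.inv₀ (by fun_prop) fun s => by positivity

lemma hasDerivAt_lowWeight (s : ℝ) :
    HasDerivAt lowWeight (-(4 * s * ((1 + s ^ 2) ^ 3)⁻¹)) s := by
  have h1 : HasDerivAt (fun s : ℝ => (1 + s ^ 2) ^ 2) (2 * (1 + s ^ 2) * (2 * s)) s := by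
    have := (((hasDerivAt_pow 2 s).const_add 1).pow 2)
    simpa using! this
  have h2 : 1 + s ^ 2 ≠ 0 := by positivity
  convert! h1.inv (by positivity) using 1
  field_simp; ring

lemma lowWeight_nonneg (s : ℝ) : 0 ≤ lowWeight s := by unfold lowWeight; positivity

lemma lowWeight_le_one (s : ℝ) : lowWeight s ≤ 1 :=
  inv_le_one_of_one_le₀ (one_le_pow₀ (by nlinarith [sq_nonneg s]))

lemma one_sub_lowWeight_le (s : ℝ) : 1 - lowWeight s ≤ 2 * s ^ 2 := by
  have h : 1 - 2 * s ^ 2 ≤ lowWeight s := by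
    rw [lowWeight, ← one_div, le_div_iff₀ (by positivity)]
    nlinarith [sq_nonneg s, sq_nonneg (s ^ 2), mul_nonneg (sq_nonneg s) (sq_nonneg (s ^ 2))]
  linarith

/-- A quantity that is at most `1` and at most `K s²` compensates for the difference between the
inhomogeneous weight `1 + |s|` and the homogeneous one `|s|`. -/
lemma sq_mul_one_add_abs_le {v K s : ℝ} (h0 : 0 ≤ v) (h1 : v ≤ 1) (h2 : v ≤ K * s ^ 2)
    (hK : 1 ≤ K) : v ^ 2 * (1 + |s|) ≤ 2 * K * |s| := by
  have hs := abs_nonneg s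
  have h3 : v ^ 2 ≤ v := by nlinarith
  rcases le_total |s| 1 with h | h
  · have h4 : v ≤ K * |s| := by
      rw [← sq_abs] at h2
      nlinarith
    nlinarith
  · nlinarith

namespace IsSymbol

variable {A : ℕ → ℝ} {b : ℝ → ℂ}

lemma norm_sq_le (h : IsSymbol (1 / 2) A b) (s : ℝ) : ‖b s‖ ^ 2 ≤ A 0 ^ 2 * (1 + |s|) := by
  have h1 := h.bound 0 s
  rw [iteratedDeriv_zero] at h1
  have h2 : 0 ≤ 1 + |s| := by positivity
  calc ‖b s‖ ^ 2 ≤ (A 0 * (1 + |s|) ^ (1 / 2 - ((0 : ℕ) : ℝ))) ^ 2 := by gcongr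
    _ = _ := by
      rw [mul_pow, ← Real.rpow_mul_natCast h2]
      norm_num

lemma norm_deriv_sq_le (h : IsSymbol (1 / 2) A b) (s : ℝ) :
    ‖deriv b s‖ ^ 2 ≤ A 1 ^ 2 * (1 + |s|)⁻¹ := by
  have h1 := h.bound 1 s
  rw [iteratedDeriv_one] at h1
  have h2 : 0 ≤ 1 + |s| := by positivity
  calc ‖deriv b s‖ ^ 2 ≤ (A 1 * (1 + |s|) ^ (1 / 2 - ((1 : ℕ) : ℝ))) ^ 2 := by gcongr
    _ = _ := by
      rw [mul_pow, ← Real.rpow_mul_natCast h2, ← Real.rpow_neg_one]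
      norm_num

/-- The high-frequency part of a symbol, rescaled by `a²`, is an amplitude. -/
lemma isAmplitude (h : IsSymbol (1 / 2) A b) {a S : ℝ} (ha : 0 < a)
    (hS : ∀ s, b s ≠ 0 → |s| ≤ S * a ^ 2) :
    IsAmplitude S ((2 * |A 1| + 8 * |A 0|) * a)
      (fun s => (1 - lowWeight (a ^ 2 * s) : ℝ) * b (a ^ 2 * s))
      (fun s => (a ^ 2 : ℝ) * ((4 * (a ^ 2 * s) * ((1 + (a ^ 2 * s) ^ 2) ^ 3)⁻¹ : ℝ) *
        b (a ^ 2 * s) + (1 - lowWeight (a ^ 2 * s) : ℝ) * deriv b (a ^ 2 * s))) := by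
  have hd : ∀ t, HasDerivAt (fun t => ((1 - lowWeight t : ℝ) : ℂ) * b t)
      ((4 * t * ((1 + t ^ 2) ^ 3)⁻¹ : ℝ) * b t + (1 - lowWeight t : ℝ) * deriv b t) t := by
    intro t
    have h1 := ((hasDerivAt_lowWeight t).const_sub 1).ofReal_comp
    rw [neg_neg] at h1
    exact h1.mul ((h.smooth.differentiable (by simp)).differentiableAt.hasDerivAt)
  have hM : 4 * A 1 ^ 2 + 64 * A 0 ^ 2 ≤ (2 * |A 1| + 8 * |A 0|) ^ 2 := by
    have : 0 ≤ |A 1| * |A 0| := by positivity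
    nlinarith [sq_abs (A 1), sq_abs (A 0)]
  have ha2 : ∀ s, |a ^ 2 * s| = a ^ 2 * |s| := fun s => by rw [abs_mul, abs_of_pos (by positivity)]
  refine ⟨fun s => ?_, ?_, fun s hs => ?_, fun s => ?_, fun s => ?_⟩
  · have h1 : HasDerivAt (fun s : ℝ => a ^ 2 * s) (a ^ 2) s := by
      simpa using (hasDerivAt_id s).const_mul (a ^ 2)
    rw [← Complex.real_smul]
    exact (hd (a ^ 2 * s)).scomp s h1
  · have h1 : Continuous b := h.smooth.continuous
    have h2 : Continuous (deriv b) := h.smooth.continuous_deriv (by simp)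
    have h3 : Continuous fun s : ℝ => ((1 + (a ^ 2 * s) ^ 2) ^ 3)⁻¹ :=
      Continuous.inv₀ (by fun_prop) fun s => by positivity
    fun_prop
  · have h1 := hS _ (right_ne_zero_of_mul hs)
    rw [ha2, mul_comm] at h1
    exact le_of_mul_le_mul_right h1 (by positivity)
  · obtain ⟨t, ht⟩ : ∃ t, t = a ^ 2 * s := ⟨_, rfl⟩
    have h1 := sq_mul_one_add_abs_le (s := t) (sub_nonneg.2 (lowWeight_le_one t))
      (sub_le_self _ (lowWeight_nonneg t)) (one_sub_lowWeight_le t) one_le_two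
    have h2 := h.norm_sq_le t
    rw [← ht, norm_mul, mul_pow, Complex.norm_real, Real.norm_eq_abs, sq_abs]
    calc (1 - lowWeight t) ^ 2 * ‖b t‖ ^ 2 ≤ (1 - lowWeight t) ^ 2 * (A 0 ^ 2 * (1 + |t|)) := by
          gcongr
      _ = A 0 ^ 2 * ((1 - lowWeight t) ^ 2 * (1 + |t|)) := by ring
      _ ≤ A 0 ^ 2 * (2 * 2 * |t|) := by gcongr
      _ = 4 * A 0 ^ 2 * |t| := by ring
      _ ≤ (2 * |A 1| + 8 * |A 0|) ^ 2 * |t| := by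
          gcongr
          nlinarith [sq_nonneg (A 0), sq_nonneg (A 1)]
      _ = _ := by rw [ht, ha2]; ring
  · obtain ⟨t, ht⟩ : ∃ t, t = a ^ 2 * s := ⟨_, rfl⟩
    have h1 : ((s : ℝ) : ℂ) * ((a ^ 2 : ℝ) * ((4 * t * ((1 + t ^ 2) ^ 3)⁻¹ : ℝ) *
        b t + (1 - lowWeight t : ℝ) * deriv b t)) =
        ((4 * (t ^ 2 * ((1 + t ^ 2) ^ 3)⁻¹) : ℝ) : ℂ) * b t +
          ((t * (1 - lowWeight t) : ℝ) : ℂ) * deriv b t := by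
      rw [ht]; push_cast; ring
    obtain ⟨v, hv⟩ : ∃ v, v = t ^ 2 * ((1 + t ^ 2) ^ 3)⁻¹ := ⟨_, rfl⟩
    have hv0 : 0 ≤ v := by rw [hv]; positivity
    have hv1 : v ≤ t ^ 2 := by
      rw [hv]
      exact mul_le_of_le_one_right (sq_nonneg t)
        (inv_le_one_of_one_le₀ (one_le_pow₀ (by nlinarith [sq_nonneg t])))
    have hv2 : v ≤ 1 := by
      rw [hv, mul_inv_le_iff₀ (by positivity), one_mul]
      nlinarith [sq_nonneg t, sq_nonneg (t ^ 2), mul_nonneg (sq_nonneg t) (sq_nonneg (t ^ 2))]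
    have h2 := sq_mul_one_add_abs_le (K := 1) (s := t) hv0 hv2 (by linarith) le_rfl
    have h3 : ‖((4 * v : ℝ) : ℂ) * b t‖ ^ 2 ≤ 32 * A 0 ^ 2 * |t| := by
      rw [norm_mul, mul_pow, Complex.norm_real, Real.norm_eq_abs, sq_abs]
      calc (4 * v) ^ 2 * ‖b t‖ ^ 2 ≤ (4 * v) ^ 2 * (A 0 ^ 2 * (1 + |t|)) := by
            gcongr; exact h.norm_sq_le t
        _ = 16 * A 0 ^ 2 * (v ^ 2 * (1 + |t|)) := by ring
        _ ≤ 16 * A 0 ^ 2 * (2 * 1 * |t|) := by gcongr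
        _ = _ := by ring
    have h4 : ‖((t * (1 - lowWeight t) : ℝ) : ℂ) * deriv b t‖ ^ 2 ≤ A 1 ^ 2 * |t| := by
      rw [norm_mul, mul_pow, Complex.norm_real, Real.norm_eq_abs, sq_abs, mul_pow]
      have h5 : (1 - lowWeight t) ^ 2 ≤ 1 :=
        pow_le_one₀ (sub_nonneg.2 (lowWeight_le_one t)) (sub_le_self _ (lowWeight_nonneg t))
      calc t ^ 2 * (1 - lowWeight t) ^ 2 * ‖deriv b t‖ ^ 2
          ≤ t ^ 2 * 1 * (A 1 ^ 2 * (1 + |t|)⁻¹) := by gcongr; exact h.norm_deriv_sq_le t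
        _ = A 1 ^ 2 * (|t| * (|t| * (1 + |t|)⁻¹)) := by rw [← sq_abs t]; ring
        _ ≤ A 1 ^ 2 * (|t| * 1) := by
            gcongr
            rw [mul_inv_le_iff₀ (by positivity)]
            linarith
        _ = _ := by ring
    rw [← ht, h1, ← hv]
    have h6 := norm_add_le (((4 * v : ℝ) : ℂ) * b t)
      (((t * (1 - lowWeight t) : ℝ) : ℂ) * deriv b t)
    calc _ ≤ (‖((4 * v : ℝ) : ℂ) * b t‖ +
          ‖((t * (1 - lowWeight t) : ℝ) : ℂ) * deriv b t‖) ^ 2 := by gcongr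
      _ ≤ 2 * (32 * A 0 ^ 2 * |t|) + 2 * (A 1 ^ 2 * |t|) := by
          nlinarith [sq_nonneg (‖((4 * v : ℝ) : ℂ) * b t‖ -
            ‖((t * (1 - lowWeight t) : ℝ) : ℂ) * deriv b t‖)]
      _ = (2 * A 1 ^ 2 + 64 * A 0 ^ 2) * |t| := by ring
      _ ≤ (2 * |A 1| + 8 * |A 0|) ^ 2 * |t| := by
          gcongr
          nlinarith [sq_nonneg (A 1)]
      _ = _ := by rw [ht, ha2]; ring

/-- The low-frequency part of a symbol, rescaled by `a²`, is integrable with an `L¹` norm of order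
`a⁻²`. -/
lemma integral_lowWeight_mul_le (h : IsSymbol (1 / 2) A b) {a : ℝ} (ha : 0 < a) :
    ∫⁻ s, ‖(lowWeight (a ^ 2 * s) : ℂ) * b (a ^ 2 * s)‖ₑ ≤
      ENNReal.ofReal (2 * Real.pi * |A 0| / a ^ 2) := by
  have h1 : ∀ t, ‖(lowWeight t : ℂ) * b t‖ ≤ 2 * |A 0| * (1 + t ^ 2)⁻¹ := by
    intro t
    have h2 : ‖b t‖ ≤ |A 0| * (2 * (1 + t ^ 2)) := by
      refine abs_le_of_sq_le_sq' ?_ (by positivity) |>.2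
      refine (h.norm_sq_le t).trans ?_
      rw [mul_pow, sq_abs]
      gcongr
      nlinarith [sq_abs t, abs_nonneg t, sq_nonneg (|t| - 1), sq_nonneg (t ^ 2)]
    rw [norm_mul, Complex.norm_real, Real.norm_of_nonneg (lowWeight_nonneg t), lowWeight]
    calc ((1 + t ^ 2) ^ 2)⁻¹ * ‖b t‖ ≤ ((1 + t ^ 2) ^ 2)⁻¹ * (|A 0| * (2 * (1 + t ^ 2))) := by
          gcongr
      _ = _ := by field_simp
  calc _ ≤ ∫⁻ s, ENNReal.ofReal (2 * |A 0| * (1 + (a ^ 2 * s) ^ 2)⁻¹) := by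
        refine lintegral_mono fun s => ?_
        rw [← ofReal_norm]
        exact ENNReal.ofReal_le_ofReal (h1 _)
    _ = ENNReal.ofReal (∫ s, 2 * |A 0| * (1 + (a ^ 2 * s) ^ 2)⁻¹) := by
        rw [ofReal_integral_eq_lintegral_ofReal]
        · exact (integrable_inv_one_add_sq.comp_mul_left' (pow_pos ha 2).ne').const_mul _
        · exact .of_forall fun s => by positivity
    _ = _ := by
        rw [integral_const_mul, Measure.integral_comp_mul_left (fun t => (1 + t ^ 2)⁻¹) (a ^ 2),
          integral_univ_inv_one_add_sq, smul_eq_mul,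
          abs_of_pos (inv_pos.2 (pow_pos ha 2))]
        congr 1
        field_simp

end IsSymbol

/-! ### The operator in terms of the oscillatory integral -/

lemma measurable_intCast_snd : Measurable fun y : ℝ × ℤ => (y.1, (y.2 : ℝ)) :=
  measurable_fst.prodMk ((measurable_of_countable _).comp measurable_snd)

instance : SFinite μ := by unfold μ; infer_instance

lemma map_prodMk_le (n : ℤ) : (volume : Measure ℝ).map (fun x => (x, n)) ≤ μ := by
  refine Measure.le_iff.2 fun s hs => ?_
  rw [Measure.map_apply measurable_prodMk_right hs, μ, Measure.prod_apply_symm hs, lintegral_count]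
  exact ENNReal.le_tsum n

lemma memLp_slice {H : ℝ × ℤ → ℂ} {p : ℝ≥0∞} (h : MemLp H p μ) (n : ℤ) :
    MemLp (fun x => H (x, n)) p :=
  (measurableEmbedding_prod_mk_right n).memLp_map_measure_iff.1 (h.mono_measure (map_prodMk_le n))

lemma sum_lintegral_slice_le {H : ℝ × ℤ → ℂ} (h : AEStronglyMeasurable H μ) (N : Finset ℤ) :
    ∑ n ∈ N, ∫⁻ x, ‖H (x, n)‖ₑ ^ 2 ≤ ∫⁻ w, ‖H w‖ₑ ^ 2 ∂μ := by
  rw [μ, lintegral_prod_symm _ (by rw [← μ]; exact h.enorm.pow_const 2), lintegral_count]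
  exact ENNReal.sum_le_tsum N

/-- The Fourier transform of `H`, as an integral over `ℝ × ℤ` and as a sum over slices. -/
lemma integral_e_mul_eq_fourierSum {H : ℝ × ℤ → ℂ} {N : Finset ℤ} (hH : Integrable H μ)
    (hN : ∀ w, H w ≠ 0 → w.2 ∈ N) (y : ℝ × ℝ) :
    ∫ w, e (-(y.1 * w.1 + y.2 * w.2)) * H w ∂μ = fourierSum N (fun n x => H (x, n)) y := by
  have hc : Measurable fun w : ℝ × ℤ => e (-(y.1 * w.1 + y.2 * w.2)) :=
    (by fun_prop : Measurable fun w : ℝ × ℝ => e (-(y.1 * w.1 + y.2 * w.2))).comp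
      measurable_intCast_snd
  have hi : Integrable (fun w => e (-(y.1 * w.1 + y.2 * w.2)) * H w) μ :=
    hH.bdd_mul (c := 1) hc.aestronglyMeasurable (.of_forall fun w => (norm_e _).le)
  rw [μ] at hi ⊢
  rw [integral_prod_symm _ hi, integral_countable hi.integral_prod_right]
  rw [tsum_eq_sum (s := N)]
  · refine Finset.sum_congr rfl fun n _ => ?_
    rw [Measure.real, Measure.count_singleton, ENNReal.toReal_one, one_smul,
      fourier_eq_integral_e, ← integral_const_mul]
    refine integral_congr_ae (.of_forall fun x => ?_)
    have : -(y.1 * x + y.2 * n) = -(n * y.2) + -(x * y.1) := by ring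
    simp only [this, e_add]
    ring
  · intro n hn
    have : ∀ x, H (x, n) = 0 := fun x => by_contra fun h => hn (hN _ h)
    simp [this]

lemma dot_sub (y w : ℝ × ℤ) :
    dot (y - w) y = (y.1 ^ 2 + (y.2 : ℝ) ^ 2) + -(y.1 * w.1 + y.2 * w.2) := by
  simp only [dot, Prod.fst_sub, Prod.snd_sub, Int.cast_sub]
  ring

lemma integrand_eq (δ : ℝ) (b : ℝ → ℂ) (χ : ℝ × ℝ → ℝ) (G : ℝ × ℤ → ℂ) (y w : ℝ × ℤ) (s : ℝ) :
    integrand δ b χ G y w s = χ (y.1, y.2) * (e ((δ ^ 2)⁻¹ * s * dot (y - w) y) *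
      ((χ (w.1, w.2) * G w) * b s)) := by
  rw [integrand, e]
  push_cast; ring

lemma integrable_integrand {δ : ℝ} {b : ℝ → ℂ} {χ : ℝ × ℝ → ℝ} {G : ℝ × ℤ → ℂ}
    (hb : Integrable b) (hG : Integrable (fun w => (χ (w.1, w.2) : ℂ) * G w) μ) (y : ℝ × ℤ) :
    Integrable (fun p : (ℝ × ℤ) × ℝ => integrand δ b χ G y p.1 p.2) (μ.prod volume) := by
  simp_rw [integrand_eq]
  refine Integrable.const_mul ?_ _
  refine (hG.mul_prod hb).bdd_mul (c := 1) ?_ (.of_forall fun w => (norm_e _).le)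
  simp_rw [dot_sub]
  have : Continuous fun q : (ℝ × ℝ) × ℝ =>
      e ((δ ^ 2)⁻¹ * q.2 * (y.1 ^ 2 + (y.2 : ℝ) ^ 2 + -(y.1 * q.1.1 + y.2 * q.1.2))) := by fun_prop
  exact (this.measurable.comp ((measurable_intCast_snd.comp measurable_fst).prodMk
    measurable_snd)).aestronglyMeasurable

/-- The operator `V` in terms of the oscillatory integral of the Fourier transform of `χ G`. -/
lemma V_eq_oscInt {δ : ℝ} (hδ : 0 < δ) {b : ℝ → ℂ} {χ : ℝ × ℝ → ℝ} {G : ℝ × ℤ → ℂ}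
    (hb : Integrable b) (hG : Integrable (fun w => (χ (w.1, w.2) : ℂ) * G w) μ) {N : Finset ℤ}
    (hN : ∀ w : ℝ × ℤ, (χ (w.1, w.2) : ℂ) * G w ≠ 0 → w.2 ∈ N) (y : ℝ × ℤ) :
    V δ b χ G y = χ (y.1, y.2) * oscInt (fun s => b (δ ^ 2 * s))
      (fourierSum N fun n x => (χ (x, n) : ℂ) * G (x, n)) (y.1, y.2) := by
  have hδ2 : 0 < δ ^ 2 := by positivity
  obtain ⟨F, hF⟩ : ∃ F, F = fourierSum N fun n x => (χ (x, n) : ℂ) * G (x, n) := ⟨_, rfl⟩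
  obtain ⟨k, hk⟩ : ∃ k : ℝ → ℂ, k = fun t =>
    b (δ ^ 2 * t) * e (t * (y.1 ^ 2 + (y.2 : ℝ) ^ 2)) * F (t * y.1, t * y.2) := ⟨_, rfl⟩
  have h1 : ∀ s, ∫ w, integrand δ b χ G y w s ∂μ = χ (y.1, y.2) * k ((δ ^ 2)⁻¹ * s) := by
    intro s
    have h2 := integral_e_mul_eq_fourierSum hG hN ((δ ^ 2)⁻¹ * s * y.1, (δ ^ 2)⁻¹ * s * y.2)
    simp_rw [integrand_eq, integral_const_mul]
    congr 1
    simp only [hk]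
    rw [hF, ← h2, ← integral_const_mul]
    refine integral_congr_ae (.of_forall fun w => ?_)
    have h3 : (δ ^ 2)⁻¹ * s * dot (y - w) y = (δ ^ 2)⁻¹ * s * (y.1 ^ 2 + (y.2 : ℝ) ^ 2) +
        -((δ ^ 2)⁻¹ * s * y.1 * w.1 + (δ ^ 2)⁻¹ * s * y.2 * w.2) := by
      rw [dot_sub]; ring
    have h4 : δ ^ 2 * ((δ ^ 2)⁻¹ * s) = s := by field_simp
    simp only [h3, e_add, h4]
    ring
  rw [V, integral_integral_swap (integrable_integrand hb hG y)]
  simp_rw [h1]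
  rw [integral_const_mul, Measure.integral_comp_mul_left, inv_inv, abs_of_pos hδ2,
    Complex.real_smul, oscInt, ← hF, hk]
  have : ((δ ^ 2 : ℝ) : ℂ) ≠ 0 := by exact_mod_cast hδ2.ne'
  rw [Complex.ofReal_inv, mul_left_comm, inv_mul_cancel_left₀ this]

/-- The trivial bound for the oscillatory integral, by the `L¹` norm of the amplitude. -/
lemma enorm_oscInt_le {β : ℝ → ℂ} {H : ℝ × ℤ → ℂ} {N : Finset ℤ} (hH : Integrable H μ)
    (hN : ∀ w, H w ≠ 0 → w.2 ∈ N) (y : ℝ × ℝ) :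
    ‖oscInt β (fourierSum N fun n x => H (x, n)) y‖ₑ ≤ (∫⁻ s, ‖β s‖ₑ) * ∫⁻ w, ‖H w‖ₑ ∂μ := by
  have he : ∀ x, ‖e x‖ₑ = 1 := fun x => by rw [← ofReal_norm, norm_e, ENNReal.ofReal_one]
  have hF : ∀ z, ‖fourierSum N (fun n x => H (x, n)) z‖ₑ ≤ ∫⁻ w, ‖H w‖ₑ ∂μ := by
    intro z
    rw [← integral_e_mul_eq_fourierSum hH hN]
    refine (enorm_integral_le_lintegral_enorm _).trans_eq ?_
    simp only [enorm_mul, he, one_mul]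
  rw [oscInt]
  refine (enorm_integral_le_lintegral_enorm _).trans ?_
  rw [← lintegral_mul_const' _ _ hH.2.ne]
  refine lintegral_mono fun s => ?_
  rw [enorm_mul, enorm_mul, he, mul_one]
  gcongr
  exact hF _

/-- The Cauchy-Schwarz inequality for a function supported in `Q`. -/
lemma lintegral_enorm_sq_le {H : ℝ × ℤ → ℂ} (hH : AEStronglyMeasurable H μ) {Q : Set (ℝ × ℤ)}
    (hQ : MeasurableSet Q) (hs : ∀ w, H w ≠ 0 → w ∈ Q) :
    (∫⁻ w, ‖H w‖ₑ ∂μ) ^ 2 ≤ μ Q * ∫⁻ w, ‖H w‖ₑ ^ 2 ∂μ := by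
  have h1 : ∀ w, ‖H w‖ₑ = Q.indicator (fun _ => (1 : ℝ≥0∞)) w * ‖H w‖ₑ := by
    intro w
    by_cases hw : w ∈ Q
    · simp [hw]
    · have : H w = 0 := by_contra fun h => hw (hs w h)
      simp [this]
  have h2 := ENNReal.lintegral_mul_le_Lp_mul_Lq μ Real.HolderConjugate.two_two
    (f := Q.indicator fun _ => (1 : ℝ≥0∞)) (g := fun w => ‖H w‖ₑ)
    (measurable_const.indicator hQ).aemeasurable hH.enorm
  have h3 : ∫⁻ w, Q.indicator (fun _ => (1 : ℝ≥0∞)) w ^ 2 ∂μ = μ Q := by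
    rw [← lintegral_indicator_one hQ]
    refine lintegral_congr fun w => ?_
    by_cases hw : w ∈ Q <;> simp [hw]
  simp only [Pi.mul_apply, ← h1, ENNReal.rpow_ofNat, h3] at h2
  refine (pow_le_pow_left' h2 2).trans_eq ?_
  rw [mul_pow, ← ENNReal.rpow_natCast, ← ENNReal.rpow_natCast, ← ENNReal.rpow_mul,
    ← ENNReal.rpow_mul]
  norm_num

/-! ### The bound for a cut-off near a point -/

/-- The box of side `2a` about the point `p` of the plane, as a subset of `ℝ × ℤ`. -/
def latticeBox (p : ℝ × ℝ) (a : ℝ) : Set (ℝ × ℤ) :=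
  Icc (p.1 - a) (p.1 + a) ×ˢ (Finset.Icc ⌈p.2 - a⌉ ⌊p.2 + a⌋ : Finset ℤ)

lemma mem_latticeBox {p : ℝ × ℝ} {a : ℝ} {y : ℝ × ℤ} :
    y ∈ latticeBox p a ↔ |y.1 - p.1| ≤ a ∧ |(y.2 : ℝ) - p.2| ≤ a := by
  simp only [latticeBox, mem_prod, mem_Icc, Finset.coe_Icc, Int.ceil_le, Int.le_floor, abs_le]
  constructor <;> rintro ⟨⟨h1, h2⟩, h3, h4⟩ <;>
    exact ⟨⟨by linarith, by linarith⟩, by linarith, by linarith⟩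

lemma measurableSet_latticeBox (p : ℝ × ℝ) (a : ℝ) : MeasurableSet (latticeBox p a) :=
  measurableSet_Icc.prod (Finset.measurableSet _)

lemma measure_latticeBox_le (p : ℝ × ℝ) {a : ℝ} (ha : 1 ≤ a) :
    μ (latticeBox p a) ≤ ENNReal.ofReal (6 * a ^ 2) := by
  rw [latticeBox, μ, Measure.prod_prod, Real.volume_Icc, Measure.count_apply_finset, Int.card_Icc,
    ← ENNReal.ofReal_natCast, ← ENNReal.ofReal_mul (by linarith)]
  apply ENNReal.ofReal_le_ofReal
  have h1 : ((⌊p.2 + a⌋ + 1 - ⌈p.2 - a⌉).toNat : ℝ) ≤ 3 * a := by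
    rw [← Int.cast_natCast, Int.ofNat_toNat, Int.cast_max]
    refine max_le ?_ (by simpa using by linarith)
    push_cast
    linarith [Int.floor_le (p.2 + a), Int.le_ceil (p.2 - a)]
  have h2 : p.1 + a - (p.1 - a) = 2 * a := by ring
  rw [h2]
  calc _ ≤ 2 * a * (3 * a) := by gcongr
    _ = _ := by ring

/-- A box that is small compared with its distance from the origin lies in an annulus. -/
lemma mem_annulus_of_near {d x t : ℝ} {p : ℝ × ℝ} (hp : p.1 ^ 2 + p.2 ^ 2 = d ^ 2)
    (hv : (x - p.1) ^ 2 + (t - p.2) ^ 2 ≤ (d / 4) ^ 2) : (x, t) ∈ annulus (2 * d / 3) := by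
  obtain ⟨u, hu⟩ : ∃ u, u = x - p.1 := ⟨_, rfl⟩
  obtain ⟨v, hv'⟩ : ∃ v, v = t - p.2 := ⟨_, rfl⟩
  rw [← hu, ← hv'] at hv
  have hx : x = p.1 + u := by rw [hu]; ring
  have ht : t = p.2 + v := by rw [hv']; ring
  have h1 : |p.1 * u + p.2 * v| ≤ d ^ 2 / 4 := by
    apply abs_le_of_sq_le_sq _ (by positivity)
    calc (p.1 * u + p.2 * v) ^ 2 ≤ (p.1 ^ 2 + p.2 ^ 2) * (u ^ 2 + v ^ 2) := by
          nlinarith [sq_nonneg (p.1 * v - p.2 * u)]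
      _ ≤ d ^ 2 * (d / 4) ^ 2 := by rw [hp]; gcongr
      _ = _ := by ring
  have h2 := abs_le.1 h1
  have h3 : x ^ 2 + t ^ 2 = d ^ 2 + 2 * (p.1 * u + p.2 * v) + (u ^ 2 + v ^ 2) := by
    rw [hx, ht, ← hp]; ring
  constructor
  · show (2 * d / 3) ^ 2 ≤ x ^ 2 + t ^ 2
    rw [h3]
    nlinarith [sq_nonneg u, sq_nonneg v, sq_nonneg d]
  · show x ^ 2 + t ^ 2 ≤ (2 * (2 * d / 3)) ^ 2
    rw [h3]
    nlinarith [sq_nonneg d]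

/-- The contribution of the low frequencies, which the size of the kernel controls. -/
lemma lintegral_oscInt_low_le {β : ℝ → ℂ} {H : ℝ × ℤ → ℂ} {N : Finset ℤ} {Q : Set (ℝ × ℤ)}
    {a Cβ : ℝ} (hH : Integrable H μ) (hN : ∀ w, H w ≠ 0 → w.2 ∈ N) (hQ : MeasurableSet Q)
    (hs : ∀ w, H w ≠ 0 → w ∈ Q) (ha : 0 ≤ a) (hQa : μ Q ≤ ENNReal.ofReal a) (hC : 0 ≤ Cβ)
    (hβ : ∫⁻ s, ‖β s‖ₑ ≤ ENNReal.ofReal Cβ) :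
    ∫⁻ y in Q, ‖oscInt β (fourierSum N fun n x => H (x, n)) (y.1, y.2)‖ₑ ^ 2 ∂μ ≤
      ENNReal.ofReal ((a * Cβ) ^ 2) * ∫⁻ w, ‖H w‖ₑ ^ 2 ∂μ := by
  calc _ ≤ ∫⁻ y in Q, ENNReal.ofReal Cβ ^ 2 * (∫⁻ w, ‖H w‖ₑ ∂μ) ^ 2 ∂μ := by
        refine lintegral_mono fun y => ?_
        rw [← mul_pow]
        gcongr
        exact (enorm_oscInt_le hH hN _).trans (by gcongr)
    _ = ENNReal.ofReal Cβ ^ 2 * (∫⁻ w, ‖H w‖ₑ ∂μ) ^ 2 * μ Q := setLIntegral_const _ _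
    _ ≤ ENNReal.ofReal Cβ ^ 2 * (ENNReal.ofReal a * ∫⁻ w, ‖H w‖ₑ ^ 2 ∂μ) *
        ENNReal.ofReal a := by
        gcongr
        exact (lintegral_enorm_sq_le hH.1 hQ hs).trans (by gcongr)
    _ = _ := by
        rw [ENNReal.ofReal_pow (by positivity), ENNReal.ofReal_mul ha]
        ring

lemma oscInt_add {β₁ β₂ : ℝ → ℂ} (h₁ : Integrable β₁) (h₂ : Integrable β₂) {F : ℝ × ℝ → ℂ}
    (hF : Continuous F) {C : ℝ} (hC : ∀ y, ‖F y‖ ≤ C) (y : ℝ × ℝ) :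
    oscInt (fun s => β₁ s + β₂ s) F y = oscInt β₁ F y + oscInt β₂ F y := by
  have hi : ∀ {β : ℝ → ℂ}, Integrable β →
      Integrable fun s => β s * e (s * (y.1 ^ 2 + y.2 ^ 2)) * F (s * y.1, s * y.2) := by
    intro β hβ
    have h3 : Continuous fun s : ℝ => e (s * (y.1 ^ 2 + y.2 ^ 2)) * F (s * y.1, s * y.2) := by
      fun_prop
    have h4 := hβ.mul_bdd (c := C) h3.aestronglyMeasurable (.of_forall fun s => by
      rw [norm_mul, norm_e, one_mul]; exact hC _)
    simpa only [mul_assoc] using h4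
  rw [oscInt, oscInt, oscInt, ← integral_add (hi h₁) (hi h₂)]
  refine integral_congr_ae (.of_forall fun s => ?_)
  simp only [add_mul]

/-- A bound for the square of the operator norm of `V`, as a function of the bounds `A₀`, `A₁`
for the symbol, `B₀` for the cut-off function, and the size `κ` of its support in units of `δ`. -/
noncomputable def opBound (κ A₀ A₁ B₀ : ℝ) : ℝ :=
  B₀ ^ 2 * (2 * ((12 * Real.pi * κ ^ 2 * |A₀|) ^ 2 + 400000 * (2 * |A₁| + 8 * |A₀|) ^ 2) * B₀ ^ 2)

theorem lintegral_V_sq_le {κ δ T d B₀ : ℝ} {p : ℝ × ℝ} {A : ℕ → ℝ} {b : ℝ → ℂ} {χ : ℝ × ℝ → ℝ}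
    {G : ℝ × ℤ → ℂ} (hκ : 1 ≤ κ) (hδ : 1 ≤ δ) (hT : 0 < T) (hTδ : T * δ ≤ 1)
    (hp : p.1 ^ 2 + p.2 ^ 2 = d ^ 2) (hd : 12 * κ * δ ≤ d) (hb : IsSymbol (1 / 2) A b)
    (hbT : ∀ s, b s ≠ 0 → |s| ≤ T / 4 * δ ^ 2) (hχ : Continuous χ) (hχB : ∀ x, |χ x| ≤ B₀)
    (hχp : ∀ x, χ x ≠ 0 → |x.1 - p.1| ≤ κ * δ ∧ |x.2 - p.2| ≤ κ * δ) (hG : MemLp G 2 μ) :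
    (∀ y, Integrable (fun p : (ℝ × ℤ) × ℝ => integrand δ b χ G y p.1 p.2) (μ.prod volume)) ∧
      AEStronglyMeasurable (V δ b χ G) μ ∧
      ∫⁻ y, ‖V δ b χ G y‖ₑ ^ 2 ∂μ ≤
        ENNReal.ofReal (opBound κ (A 0) (A 1) B₀) * ∫⁻ y, ‖G y‖ₑ ^ 2 ∂μ := by
  have hδ0 : 0 < δ := by linarith
  have hκδ : 1 ≤ κ * δ := one_le_mul_of_one_le_of_one_le hκ hδ
  have hB0 : 0 ≤ B₀ := (abs_nonneg _).trans (hχB 0)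
  obtain ⟨Q, hQ⟩ : ∃ Q, Q = latticeBox p (κ * δ) := ⟨_, rfl⟩
  obtain ⟨N, hN⟩ : ∃ N : Finset ℤ, N = Finset.Icc ⌈p.2 - κ * δ⌉ ⌊p.2 + κ * δ⌋ := ⟨_, rfl⟩
  have hQm : MeasurableSet Q := hQ ▸ measurableSet_latticeBox p _
  have hQμ : μ Q ≤ ENNReal.ofReal (6 * (κ * δ) ^ 2) := hQ ▸ measure_latticeBox_le p hκδ
  have hχQ : ∀ y : ℝ × ℤ, χ (y.1, y.2) ≠ 0 → y ∈ Q := fun y hy => by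
    rw [hQ, mem_latticeBox]; exact hχp _ hy
  obtain ⟨H, hH⟩ : ∃ H : ℝ × ℤ → ℂ, H = fun w => (χ (w.1, w.2) : ℂ) * G w := ⟨_, rfl⟩
  have hHQ : ∀ w, H w ≠ 0 → w ∈ Q := fun w hw => hχQ w fun h => hw (by rw [hH]; simp [h])
  have hHN : ∀ w, H w ≠ 0 → w.2 ∈ N := fun w hw => by
    have := hHQ w hw
    rw [hQ] at this
    rw [hN]
    exact this.2
  have hχm : Measurable fun w : ℝ × ℤ => (χ (w.1, w.2) : ℂ) :=
    Complex.measurable_ofReal.comp (hχ.measurable.comp measurable_intCast_snd)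
  have hχn : ∀ w : ℝ × ℤ, ‖(χ (w.1, w.2) : ℂ)‖ ≤ B₀ := fun w => by
    rw [Complex.norm_real]; exact hχB _
  have hH2 : MemLp H 2 μ := by
    rw [hH]
    exact hG.of_le_mul (c := B₀) (hχm.aestronglyMeasurable.mul hG.1) (.of_forall fun w => by
      rw [norm_mul]
      gcongr
      exact hχn w)
  have hHI : ∫⁻ w, ‖H w‖ₑ ^ 2 ∂μ ≤ ENNReal.ofReal (B₀ ^ 2) * ∫⁻ w, ‖G w‖ₑ ^ 2 ∂μ := by
    rw [← lintegral_const_mul' _ _ ENNReal.ofReal_ne_top]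
    refine lintegral_mono fun w => ?_
    rw [hH, enorm_mul, mul_pow]
    gcongr
    exact enorm_sq_le_ofReal (by gcongr; exact hχn w)
  have hH1 : Integrable H μ := by
    have h1 : IntegrableOn H Q μ := by
      have : IsFiniteMeasure (μ.restrict Q) :=
        ⟨by rw [Measure.restrict_apply_univ]; exact hQμ.trans_lt ENNReal.ofReal_lt_top⟩
      exact hH2.restrict Q |>.integrable one_le_two
    refine (integrableOn_iff_integrable_of_support_subset fun w hw => hHQ w hw).1 h1
  have hslice1 : ∀ n ∈ N, Integrable (fun x => H (x, n)) := fun n _ =>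
    memLp_one_iff_integrable.1 (memLp_slice (memLp_one_iff_integrable.2 hH1) n)
  have hslice2 : ∀ n ∈ N, MemLp (fun x => H (x, n)) 2 := fun n _ => memLp_slice hH2 n
  have hbc : Continuous b := hb.smooth.continuous
  have hcs : ∀ {f : ℝ → ℂ} {S : ℝ}, Continuous f → (∀ s, f s ≠ 0 → |s| ≤ S) → Integrable f :=
    fun {f S} hf hS => hf.integrable_of_hasCompactSupport
      (HasCompactSupport.intro (isCompact_Icc (a := -S) (b := S))
        fun s hs => by_contra fun h' => hs (abs_le.1 (hS s h')))
  have hbI : Integrable b := hcs hbc hbT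
  obtain ⟨F, hF⟩ : ∃ F, F = fourierSum N fun n x => H (x, n) := ⟨_, rfl⟩
  have hFc : Continuous F := hF ▸ continuous_fourierSum hslice1
  have hVU : ∀ y, V δ b χ G y = χ (y.1, y.2) * oscInt (fun s => b (δ ^ 2 * s)) F (y.1, y.2) := by
    intro y
    rw [hH] at hH1 hHN
    rw [V_eq_oscInt hδ0 hbI hH1 hHN, hF, hH]
  refine ⟨integrable_integrand hbI (hH ▸ hH1), ?_, ?_⟩
  · have : V δ b χ G = fun y => χ (y.1, y.2) * oscInt (fun s => b (δ ^ 2 * s)) F (y.1, y.2) :=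
      funext hVU
    rw [this]
    exact (hχm.mul ((measurable_oscInt (by fun_prop) hFc).comp
      measurable_intCast_snd)).aestronglyMeasurable
  -- the two parts of the amplitude
  obtain ⟨β₁, hβ₁⟩ : ∃ β₁ : ℝ → ℂ, β₁ = fun s => (lowWeight (δ ^ 2 * s) : ℂ) * b (δ ^ 2 * s) :=
    ⟨_, rfl⟩
  obtain ⟨β₂, hβ₂⟩ : ∃ β₂ : ℝ → ℂ,
    β₂ = fun s => (1 - lowWeight (δ ^ 2 * s) : ℝ) * b (δ ^ 2 * s) := ⟨_, rfl⟩
  have hamp := hb.isAmplitude hδ0 hbT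
  rw [← hβ₂] at hamp
  have hβ₁I : Integrable β₁ := by
    refine hcs (S := T / 4) (by rw [hβ₁]; fun_prop) fun s hs => ?_
    rw [hβ₁] at hs
    have h1 := hbT _ (right_ne_zero_of_mul hs)
    rw [abs_mul, abs_of_pos (by positivity : 0 < δ ^ 2), mul_comm] at h1
    exact le_of_mul_le_mul_right h1 (by positivity)
  have hsplit : ∀ y, oscInt (fun s => b (δ ^ 2 * s)) F y = oscInt β₁ F y + oscInt β₂ F y := by
    intro y
    rw [← oscInt_add hβ₁I hamp.integrable hFc (C := ∫ w, ‖H w‖ ∂μ)]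
    · congr with s
      rw [hβ₁, hβ₂]
      push_cast; ring
    · intro z
      rw [hF, ← integral_e_mul_eq_fourierSum hH1 hHN]
      refine (norm_integral_le_integral_norm _).trans_eq ?_
      simp only [norm_mul, norm_e, one_mul]
  have hlow : ∫⁻ y in Q, ‖oscInt β₁ F (y.1, y.2)‖ₑ ^ 2 ∂μ ≤
      ENNReal.ofReal ((12 * Real.pi * κ ^ 2 * |A 0|) ^ 2) * ∫⁻ w, ‖H w‖ₑ ^ 2 ∂μ := by
    have h0 := hb.integral_lowWeight_mul_le hδ0
    have h1 := lintegral_oscInt_low_le (β := β₁) (Cβ := 2 * Real.pi * |A 0| / δ ^ 2)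
      hH1 hHN hQm hHQ (by positivity) hQμ (by positivity) (by rw [hβ₁]; exact h0)
    rw [← hF] at h1
    convert! h1 using 3
    field_simp; ring
  have hhigh : ∫⁻ y in Q, ‖oscInt β₂ F (y.1, y.2)‖ₑ ^ 2 ∂μ ≤
      ENNReal.ofReal (400000 * (2 * |A 1| + 8 * |A 0|) ^ 2) * ∫⁻ w, ‖H w‖ₑ ^ 2 ∂μ := by
    have hd0 : 0 < d := lt_of_lt_of_le (by positivity) hd
    have hd' : 12 * (κ * δ) ≤ d := by linarith
    have hδκ : δ ≤ κ * δ := le_mul_of_one_le_left hδ0.le hκ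
    have h1 := lintegral_sample_oscInt_le (r₀ := 2 * d / 3) (R := 2 * d / 3 / δ) hamp
      (by positivity) (by rw [le_div_iff₀ hδ0]; linarith) (by positivity)
      (by
        rw [le_div_iff₀ hδ0]
        calc T / 4 * (2 * d / 3) * δ = T * δ * (d / 6) := by ring
          _ ≤ 1 * (d / 6) := by gcongr
          _ ≤ _ := by linarith)
      hslice1 hslice2
      (by
        intro n hn
        rw [hN, Finset.mem_Icc, Int.ceil_le, Int.le_floor] at hn
        have h2 : |p.2| ≤ d := abs_le_of_sq_le_sq (by nlinarith [sq_nonneg p.1]) hd0.le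
        rw [abs_le] at h2 ⊢
        constructor <;> linarith [hn.1, hn.2, h2.1, h2.2]) hQm
      (by
        intro y hy t ht
        rw [hQ, mem_latticeBox, abs_le, abs_le] at hy
        refine mem_annulus_of_near hp ?_
        have h3 : (y.1 - p.1) ^ 2 ≤ (d / 12) ^ 2 := sq_le_sq' (by linarith [hy.1.1])
          (by linarith [hy.1.2])
        have h4 : (t - p.2) ^ 2 ≤ (d / 6) ^ 2 := sq_le_sq' (by linarith [hy.2.1, ht.1])
          (by linarith [hy.2.2, ht.2])
        nlinarith)
    rw [← hF] at h1
    refine h1.trans ?_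
    refine (mul_le_mul_right (sum_lintegral_slice_le hH2.1 N) _).trans_eq ?_
    congr 2
    field_simp
  have hU : ∫⁻ y in Q, ‖oscInt (fun s => b (δ ^ 2 * s)) F (y.1, y.2)‖ₑ ^ 2 ∂μ ≤
      ENNReal.ofReal (2 * ((12 * Real.pi * κ ^ 2 * |A 0|) ^ 2 +
        400000 * (2 * |A 1| + 8 * |A 0|) ^ 2) * B₀ ^ 2) * ∫⁻ w, ‖G w‖ₑ ^ 2 ∂μ := by
    have hm : Measurable fun y : ℝ × ℤ => ‖oscInt β₁ F (y.1, y.2)‖ₑ ^ 2 :=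
      (((measurable_oscInt (by rw [hβ₁]; fun_prop) hFc).comp
        measurable_intCast_snd).enorm).pow_const 2
    calc _ ≤ ∫⁻ y in Q, 2 * (‖oscInt β₁ F (y.1, y.2)‖ₑ ^ 2 +
          ‖oscInt β₂ F (y.1, y.2)‖ₑ ^ 2) ∂μ := by
          refine lintegral_mono fun y => ?_
          rw [hsplit]
          exact enorm_add_sq_le _ _
      _ = 2 * ((∫⁻ y in Q, ‖oscInt β₁ F (y.1, y.2)‖ₑ ^ 2 ∂μ) +
          ∫⁻ y in Q, ‖oscInt β₂ F (y.1, y.2)‖ₑ ^ 2 ∂μ) := by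
          rw [lintegral_const_mul' _ _ ENNReal.ofNat_ne_top, lintegral_add_left hm]
      _ ≤ 2 * (ENNReal.ofReal ((12 * Real.pi * κ ^ 2 * |A 0|) ^ 2) * (∫⁻ w, ‖H w‖ₑ ^ 2 ∂μ) +
          ENNReal.ofReal (400000 * (2 * |A 1| + 8 * |A 0|) ^ 2) * ∫⁻ w, ‖H w‖ₑ ^ 2 ∂μ) := by
          gcongr
      _ = ENNReal.ofReal (2 * ((12 * Real.pi * κ ^ 2 * |A 0|) ^ 2 +
          400000 * (2 * |A 1| + 8 * |A 0|) ^ 2)) * ∫⁻ w, ‖H w‖ₑ ^ 2 ∂μ := by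
          rw [ENNReal.ofReal_mul (p := 2) (by positivity),
            ENNReal.ofReal_add (by positivity) (by positivity), ENNReal.ofReal_ofNat 2]
          ring
      _ ≤ _ := by
          rw [ENNReal.ofReal_mul (q := B₀ ^ 2) (by positivity),
            mul_assoc (ENNReal.ofReal _) (ENNReal.ofReal (B₀ ^ 2))]
          gcongr
  calc ∫⁻ y, ‖V δ b χ G y‖ₑ ^ 2 ∂μ = ∫⁻ y in Q, ‖V δ b χ G y‖ₑ ^ 2 ∂μ := by
        rw [← lintegral_indicator hQm]
        refine lintegral_congr fun y => ?_
        by_cases hy : y ∈ Q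
        · rw [indicator_of_mem hy]
        · have : χ (y.1, y.2) = 0 := by_contra fun h => hy (hχQ y h)
          rw [indicator_of_notMem hy, hVU, this]
          simp
    _ ≤ ∫⁻ y in Q, ENNReal.ofReal (B₀ ^ 2) *
        ‖oscInt (fun s => b (δ ^ 2 * s)) F (y.1, y.2)‖ₑ ^ 2 ∂μ := by
        refine lintegral_mono fun y => ?_
        rw [hVU, enorm_mul, mul_pow]
        gcongr
        exact enorm_sq_le_ofReal (by gcongr; exact hχn y)
    _ ≤ _ := by
        rw [lintegral_const_mul' _ _ ENNReal.ofReal_ne_top, opBound,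
          ENNReal.ofReal_mul (p := B₀ ^ 2) (by positivity), mul_assoc (ENNReal.ofReal (B₀ ^ 2))]
        gcongr

/-! ### Geometry of the boxes, and the conclusion -/

/-- A box contains a corner from which all its points are at distance at most `δ` in each
coordinate. That `δ` is an integer makes the corner a point of `ℝ × ℤ`. -/
lemma exists_corner {δ : ℝ} {k : ℕ} (hk : δ = k) {θ : Set (ℝ × ℤ)} (hθ : θ ∈ boxes δ) :
    ∃ q ∈ θ, ∀ y ∈ θ, |y.1 - q.1| ≤ δ ∧ |(y.2 : ℝ) - q.2| ≤ δ := by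
  obtain ⟨m, n, rfl⟩ := hθ
  have hδ : 0 ≤ δ := hk ▸ Nat.cast_nonneg k
  have hc : ((n * k : ℤ) : ℝ) = n * δ := by rw [hk]; push_cast; ring
  refine ⟨(m * δ, n * k), ⟨⟨le_rfl, ?_⟩, ?_, ?_⟩, fun y hy => ⟨?_, ?_⟩⟩
  · show m * δ ≤ (m + 1) * δ
    linarith
  · show n * δ ≤ ((n * k : ℤ) : ℝ)
    exact hc.ge
  · show ((n * k : ℤ) : ℝ) ≤ (n + 1) * δ
    rw [hc]; linarith
  · show |y.1 - m * δ| ≤ δ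
    rw [abs_le]
    constructor <;> linarith [hy.1.1, hy.1.2]
  · show |(y.2 : ℝ) - ((n * k : ℤ) : ℝ)| ≤ δ
    rw [hc, abs_le]
    constructor <;> linarith [hy.2.1, hy.2.2]

lemma distOrigin_le {θ : Set (ℝ × ℤ)} {q : ℝ × ℤ} (hq : q ∈ θ) : distOrigin θ ≤ √(dot q q) :=
  csInf_le ⟨0, by rintro _ ⟨y, _, rfl⟩; exact Real.sqrt_nonneg _⟩ (mem_image_of_mem _ hq)

lemma IsCutoff.abs_le {ρ δ : ℝ} {B : ℕ → ℝ} {θ : Set (ℝ × ℤ)} {χ : ℝ × ℝ → ℝ}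
    (h : IsCutoff ρ B δ θ χ) (x : ℝ × ℝ) : |χ x| ≤ B 0 := by
  have := h.bound 0 x
  rwa [norm_iteratedFDeriv_zero, Nat.cast_zero, neg_zero, Real.rpow_zero, mul_one,
    Real.norm_eq_abs] at this

lemma eLpNorm_two_le {f g : ℝ × ℤ → ℂ} {K : ℝ} (hK : 0 ≤ K)
    (h : ∫⁻ y, ‖f y‖ₑ ^ 2 ∂μ ≤ ENNReal.ofReal K * ∫⁻ y, ‖g y‖ₑ ^ 2 ∂μ) :
    eLpNorm f 2 μ ≤ (√K).toNNReal * eLpNorm g 2 μ := by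
  have p1 := eLpNorm_nnreal_pow_eq_lintegral (f := f) (μ := μ) (p := 2) (by norm_num)
  have p2 := eLpNorm_nnreal_pow_eq_lintegral (f := g) (μ := μ) (p := 2) (by norm_num)
  simp only [ENNReal.coe_ofNat, NNReal.coe_ofNat, ENNReal.rpow_ofNat] at p1 p2
  rw [← p1, ← p2, ← Real.sq_sqrt hK, ENNReal.ofReal_pow (Real.sqrt_nonneg K), ← mul_pow] at h
  exact (ENNReal.pow_le_pow_left_iff two_ne_zero).1 h

end Waveguide

theorem proposition2p1 (ρ : ℝ) (hρ : 0 < ρ) :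
    ∃ c : ℝ, 0 < c ∧ ∀ A B : ℕ → ℝ, ∃ C : ℝ≥0,
      ∀ (δ T : ℝ) (θ : Set (ℝ × ℤ)) (b : ℝ → ℂ) (χ : ℝ × ℝ → ℝ),
        (∃ j : ℕ, δ = 2 ^ j) → 0 < T →
        1 ≤ c * δ → δ ≤ c * T⁻¹ →
        θ ∈ Waveguide.boxes δ → δ ≤ c * Waveguide.distOrigin θ →
        Waveguide.IsSymbol (1 / 2) A b →
        tsupport b ⊆ Set.Icc (-(T * δ ^ 2 / 4)) (T * δ ^ 2 / 4) →
        Waveguide.IsCutoff ρ B δ θ χ →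
        ∀ G : ℝ × ℤ → ℂ, MemLp G 2 Waveguide.μ →
          (∀ y, Integrable (fun p : (ℝ × ℤ) × ℝ => Waveguide.integrand δ b χ G y p.1 p.2)
            (Waveguide.μ.prod volume)) ∧
          MemLp (Waveguide.V δ b χ G) 2 Waveguide.μ ∧
          eLpNorm (Waveguide.V δ b χ G) 2 Waveguide.μ ≤ C * eLpNorm G 2 Waveguide.μ := by
  have hκ : 1 ≤ 1 + ρ := by linarith
  refine ⟨(12 * (1 + ρ))⁻¹, by positivity, fun A B =>
    ⟨(√(Waveguide.opBound (1 + ρ) (A 0) (A 1) (B 0))).toNNReal, ?_⟩⟩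
  rintro δ T θ b χ ⟨j, hj⟩ hT - hδT hθ hdist hb hbT hχ G hG
  have hδ1 : 1 ≤ δ := hj ▸ one_le_pow₀ one_le_two
  have hTδ : T * δ ≤ 1 := by
    rw [← div_eq_mul_inv, le_div_iff₀ hT] at hδT
    have : (12 * (1 + ρ))⁻¹ ≤ 1 := inv_le_one_of_one_le₀ (by linarith)
    linarith
  obtain ⟨q, hq, hqθ⟩ := Waveguide.exists_corner (k := 2 ^ j) (by rw [hj]; push_cast; rfl) hθ
  have hd : 12 * (1 + ρ) * δ ≤ √(Waveguide.dot q q) := by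
    rw [le_inv_mul_iff₀ (by positivity)] at hdist
    exact hdist.trans (Waveguide.distOrigin_le hq)
  have hbT' : ∀ s, b s ≠ 0 → |s| ≤ T / 4 * δ ^ 2 := fun s hs => by
    have h1 := hbT (subset_tsupport b hs)
    exact (abs_le.2 h1).trans_eq (by ring)
  have hp : q.1 ^ 2 + (q.2 : ℝ) ^ 2 = √(Waveguide.dot q q) ^ 2 := by
    rw [Real.sq_sqrt] <;> simp only [Waveguide.dot]
    · ring
    · exact add_nonneg (mul_self_nonneg _) (mul_self_nonneg _)
  have hχp : ∀ x, χ x ≠ 0 → |x.1 - q.1| ≤ (1 + ρ) * δ ∧ |x.2 - (q.2 : ℝ)| ≤ (1 + ρ) * δ := by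
    intro x hx
    obtain ⟨y, hy, h1, h2⟩ := hχ.support x hx
    obtain ⟨h3, h4⟩ := hqθ y hy
    exact ⟨(abs_sub_le _ y.1 _).trans (by linarith),
      (abs_sub_le _ (y.2 : ℝ) _).trans (by linarith)⟩
  obtain ⟨h1, h2, h3⟩ := Waveguide.lintegral_V_sq_le (p := (q.1, (q.2 : ℝ))) hκ hδ1 hT hTδ hp hd hb
    hbT' hχ.smooth.continuous hχ.abs_le hχp hG
  have h4 := Waveguide.eLpNorm_two_le (by unfold Waveguide.opBound; positivity) h3
  exact ⟨h1, ⟨h2, h4.trans_lt (ENNReal.mul_lt_top ENNReal.coe_lt_top hG.2)⟩, h4⟩
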